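/- **Definitions.** An arc in a space $X$ is the image $A$ of an embedding $\gamma:[0,1]\to X$; its end-points are $\gamma(0),\gamma(1)$. $E(X)$ is the set of points $x\in X$ that are an end-point of every arc in $X$ containing $x$. A Cantor fan is a space homeomorphic to the union of the segments in the plane from $(0,0)$ to $(c,-1)$, $c\in C$, where $C\subseteq[0,1]$ is a Cantor set. A Lelek fan is a continuum (non-empty compact connected metrizable space) $L$ with more than one point which embeds in a Cantor fan and for which $E(L)$ is dense in $L$. Its top is the point $v$ that is an end-point of three arcs in $L$ which pairwise meet only in $v$. For a compact metric space $(X,d)$ and continuous $f:X\to X$: $(X,f)$ is transitive if for all non-empty open $U,V\subseteq X$ there is $n\ge 0$ with $f^n(U)\cap V\ne\emptyset$; it has sensitive dependence on initial conditions if there is $\varepsilon>0$ such that for all $x\in X$ and $\delta>0$ there are $y$ with $d(x,y)<\delta$ and $n\geq 1$ with $d(f^n(x),f^n(y))>\varepsilon$; $\mathcal P(f)=\{x : f^n(x)=x \text{ for some } n\ge1\}$. The inverse limit is $\varprojlim(X,f)=\{(x_1,x_2,\dots)\in\prod_{i\ge1} X : x_i=f(x_{i+1})\text{ for all } i\}$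 with shift $\sigma(x_1,x_2,x_3,\dots)=(x_2,x_3,\dots)$. Reals $r,\rho$ never connect, written $(r,\rho)\in\mathcal{NC}$, if $0<r<1<\rho$ and for all integers $k,\ell$ one has $r^k=\rho^\ell$ if and only if $k=\ell=0$. For such $r,\rho$ let $L_{r,\rho}=\{(x,y)\in[0,1]^2 : y=rx \text{ or } y=\rho x\}$, let $M_{r,\rho}=\{(x_1,x_2,\dots)\in\prod_{i\ge 1}[0,1] : (x_i,x_{i+1})\in L_{r,\rho}\text{ for all }i\}$, and let $\sigma_{r,\rho}(x_1,x_2,x_3,\dots)=(x_2,x_3,\dots)$ on $M_{r,\rho}$. **Theorem.** $\mathcal{NC}\neq\emptyset$, and for every $(r,\rho)\in\mathcal{NC}$ the inverse limit $\varprojlim(M_{r,\rho},\sigma_{r,\rho})$ is a Lelek fan with top $(\mathbf o,\mathbf o,\mathbf o,\dots)$, where $\mathbf o=(0,0,0,\dots)$. Moreover, for every Lelek fan $L$ with top $v$ (and any metric on $L$ that induces its topology) there is a homeomorphism $f:L\to L$, topologically conjugate to the shift $\sigma$ on $\varprojlim(M_{r,\rho},\sigma_{r,\rho})$, such that 1.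 $(L,f)$ is transitive, 2. $(L,f)$ has sensitive dependence on initial conditions, and 3. $\mathcal P(f)=\{v\}$; in particular, $\mathcal P(f)$ is not dense in $L$. -/

import Mathlib

open Set Topology

section Continua

variable {X : Type*} [TopologicalSpace X]

/-- `A` is an arc in `X` with end-points `a` and `b`: a homeomorphic image of `[0,1]`
under a map that sends `0` to `a` and `1` to `b`. -/
def IsArcBetween (A : Set X) (a b : X) : Prop :=
  ∃ γ : unitInterval → X, IsEmbedding γ ∧ range γ = A ∧ γ 0 = a ∧ γ 1 = b

variable (X) in
/-- The set `E(X)`: the points that are an end-point of every arc in `X` that contains them. -/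
def endPointSet : Set X :=
  {x | ∀ (A : Set X) (a b : X), IsArcBetween A a b → x ∈ A → x = a ∨ x = b}

/-- `v` is a ramification point: it is an end-point of three arcs in `X` which pairwise meet
only in `v`. The ramification point of a fan is its top. -/
def IsFanTop (v : X) : Prop :=
  ∃ (A : Fin 3 → Set X) (b : Fin 3 → X),
    (∀ i, IsArcBetween (A i) v (b i)) ∧ ∀ i j, i ≠ j → A i ∩ A j = {v}

/-- The union of the segments in the plane from `(0,0)` to `(c,-1)`, where `c ∈ C`. -/
def planarFan (C : Set ℝ) : Set (ℝ × ℝ) :=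
  ⋃ c ∈ C, segment ℝ ((0, 0) : ℝ × ℝ) (c, -1)

/-- `C` is a Cantor set in `[0,1]` (a homeomorphic copy of the ternary Cantor set). -/
def IsCantorSetInUnit (C : Set ℝ) : Prop :=
  C ⊆ Icc 0 1 ∧ Nonempty (C ≃ₜ cantorSet)

variable (X) in
/-- A Lelek fan: a nondegenerate continuum which embeds in a Cantor fan and in which the set of
end-points is dense. (The embedding makes `X` metrizable.) -/
structure IsLelekFan : Prop where
  compactSpace : CompactSpace X
  connectedSpace : ConnectedSpace X
  nontrivial : Nontrivial X
  embeds : ∃ C : Set ℝ, IsCantorSetInUnit C ∧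
    ∃ e : X → ℝ × ℝ, IsEmbedding e ∧ range e ⊆ planarFan C
  dense_endPointSet : Dense (endPointSet X)

/-- Topological transitivity of `(X, f)`. -/
def IsTransitiveSystem (f : X → X) : Prop :=
  ∀ U V : Set X, IsOpen U → IsOpen V → U.Nonempty → V.Nonempty →
    ∃ n : ℕ, ((f^[n] '' U) ∩ V).Nonempty

end Continua

/-- Sensitive dependence on initial conditions of `(X, f)`. -/
def HasSensitiveDependence {X : Type*} [MetricSpace X] (f : X → X) : Prop :=
  ∃ ε > 0, ∀ x : X, ∀ δ > 0, ∃ y ∈ Metric.ball x δ, ∃ n : ℕ, 0 < n ∧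
    ε < dist (f^[n] x) (f^[n] y)

section InverseLimits

/-- The inverse limit generated by `(X, f)`, as a subspace of the countable product of copies
of `X` (the coordinates are numbered from `0`). -/
def InverseLimit {X : Type*} (f : X → X) : Type _ :=
  {x : ℕ → X // ∀ i, x i = f (x (i + 1))}

instance {X : Type*} [TopologicalSpace X] (f : X → X) : TopologicalSpace (InverseLimit f) :=
  inferInstanceAs (TopologicalSpace {x : ℕ → X // ∀ i, x i = f (x (i + 1))})

/-- The shift `(x₁, x₂, x₃, …) ↦ (x₂, x₃, x₄, …)` on the inverse limit. -/
def InverseLimit.shift {X : Type*} (f : X → X) (x : InverseLimit f) : InverseLimit f :=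
  ⟨fun i => x.1 (i + 1), fun i => x.2 (i + 1)⟩

/-- The (one-sided) Mahavier product of the relation `F`, a subspace of the countable product. -/
def MahavierProduct {X : Type*} (F : Set (X × X)) : Type _ :=
  {x : ℕ → X // ∀ i, (x i, x (i + 1)) ∈ F}

instance {X : Type*} [TopologicalSpace X] (F : Set (X × X)) :
    TopologicalSpace (MahavierProduct F) :=
  inferInstanceAs (TopologicalSpace {x : ℕ → X // ∀ i, (x i, x (i + 1)) ∈ F})

/-- The shift `(x₁, x₂, x₃, …) ↦ (x₂, x₃, x₄, …)` on the Mahavier product. -/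
def MahavierProduct.shift {X : Type*} (F : Set (X × X)) (x : MahavierProduct F) :
    MahavierProduct F :=
  ⟨fun i => x.1 (i + 1), fun i => x.2 (i + 1)⟩

end InverseLimits

/-- The relation on `[0,1]` consisting of the pairs with `y = r x` or `y = ρ x`. -/
def lineRelation (r ρ : ℝ) : Set (unitInterval × unitInterval) :=
  {p | (p.2 : ℝ) = r * p.1} ∪ {p | (p.2 : ℝ) = ρ * p.1}

/-- `r` and `ρ` never connect. -/
def NeverConnect (r ρ : ℝ) : Prop :=
  0 < r ∧ r < 1 ∧ 1 < ρ ∧ ∀ k l : ℤ, r ^ k = ρ ^ l ↔ k = 0 ∧ l = 0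

/-- The inverse limit of the Mahavier product of the two-line relation with its shift map. -/
abbrev LelekLimit (r ρ : ℝ) : Type :=
  InverseLimit (MahavierProduct.shift (lineRelation r ρ))

/-- The point `(𝐨, 𝐨, 𝐨, …)` of the inverse limit, where `𝐨 = (0, 0, 0, …)`. -/
def LelekLimit.zero (r ρ : ℝ) : LelekLimit r ρ :=
  ⟨fun _ => ⟨fun _ => 0, fun _ => Or.inl (by simp)⟩, fun _ => rfl⟩

/-! A point of the inverse limit is a bi-infinite sequence in `[0,1]` in which each step multiplies
by `r` or by `ρ`. A non-zero point is given by its word of steps `ω : ℤ → Bool` together with its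
value `t` at index `0`. If `P_k(ω)` is the product of steps leading from index `0` to `k`, the
admissible `t` are those with `0 ≤ t ≤ inf_k 1 / P_k(ω)`. So the limit is the region under the
function `height` on a Cantor set, with the base collapsed to the zero point
(`LelekLimit.isFanParam`).

Since `log r / log ρ` is irrational, the numbers `r ^ i * ρ ^ j` approximate every positive real. A
finite window of steps can therefore be continued so that the height comes close to any prescribed
value compatible with the window. This makes `height` a Lelek function (`isLelekFunction_height`)
and the limit a Lelek fan.

Conversely, every Lelek fan is the collapsed region under a Lelek function on a compact totally
disconnected set of slopes (`IsLelekFan.exists_isFanParam`). Any two Lelek functions on such spaces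
agree up to a homeomorphism of the bases and a continuous positive factor
(`IsLelekFunction.exists_homeomorph`). The proof is a back-and-forth on clopen partitions that
controls the logarithmic ratios of suprema. Hence any Lelek fan is homeomorphic to the limit, top to
top, and the shift can be transported to it.

Transitivity uses the same approximation, to join two windows in one admissible sequence. Every open
set contains a point whose orbit ends up close to the top, and points returning far from it at
arbitrarily late times; this gives sensitivity. A non-zero periodic point would yield a relation `r
^ a * ρ ^ b = 1` with `a + b ≠ 0`, which never connecting excludes. -/

section LelekFunctions

/-! ### Lelek functions and the splitting of clopen sets with controlled suprema. -/

/-- A Lelek function: an upper semicontinuous function into `[0,1]` which is positive on a dense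
set and such that the graph is dense in the region between the graph and `0`. -/
structure IsLelekFunction {K : Type*} [TopologicalSpace K] (φ : K → ℝ) : Prop where
  usc : UpperSemicontinuous φ
  nonneg : ∀ x, 0 ≤ φ x
  le_one : ∀ x, φ x ≤ 1
  exists_pos : ∀ V : Set K, IsOpen V → V.Nonempty → ∃ y ∈ V, 0 < φ y
  exists_between : ∀ V : Set K, IsOpen V → ∀ y ∈ V, ∀ a b : ℝ, 0 ≤ a → a < b → b ≤ φ y →
    ∃ z ∈ V, a < φ z ∧ φ z < b

/-- The logarithm of the supremum of `φ` on `U`. -/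
noncomputable def logSup {K : Type*} (φ : K → ℝ) (U : Set K) : ℝ := Real.log (sSup (φ '' U))

namespace IsLelekFunction

variable {K : Type*} [TopologicalSpace K] {φ : K → ℝ}

lemma bddAbove (hφ : IsLelekFunction φ) (U : Set K) : BddAbove (φ '' U) :=
  ⟨1, by rintro _ ⟨x, -, rfl⟩; exact hφ.le_one x⟩

lemma le_sSup (hφ : IsLelekFunction φ) {U : Set K} {x : K} (hx : x ∈ U) : φ x ≤ sSup (φ '' U) :=
  le_csSup (hφ.bddAbove U) ⟨x, hx, rfl⟩

lemma exists_eq_sSup [CompactSpace K] (hφ : IsLelekFunction φ) {U : Set K} (hU : IsClopen U)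
    (hne : U.Nonempty) : ∃ y ∈ U, φ y = sSup (φ '' U) ∧ 0 < φ y := by
  obtain ⟨y, hy, hmax⟩ := (hφ.usc.upperSemicontinuousOn U).exists_isMaxOn hne hU.1.isCompact
  obtain ⟨z, hz, hz0⟩ := hφ.exists_pos U hU.2 hne
  refine ⟨y, hy, le_antisymm (hφ.le_sSup hy) (csSup_le (hne.image _) ?_), hz0.trans_le (hmax hz)⟩
  rintro _ ⟨x, hx, rfl⟩
  exact hmax hx

lemma sSup_pos [CompactSpace K] (hφ : IsLelekFunction φ) {U : Set K} (hU : IsClopen U)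
    (hne : U.Nonempty) : 0 < sSup (φ '' U) := by
  obtain ⟨y, -, h, h'⟩ := hφ.exists_eq_sSup hU hne
  exact h ▸ h'

lemma sSup_mono (hφ : IsLelekFunction φ) {U V : Set K} (h : U ⊆ V) (hne : U.Nonempty) :
    sSup (φ '' U) ≤ sSup (φ '' V) :=
  csSup_le_csSup (hφ.bddAbove V) (hne.image _) (image_mono h)

end IsLelekFunction

variable {C D : Type*} [TopologicalSpace C] [TopologicalSpace D] [CompactSpace C] [CompactSpace D]
  [T2Space D] [TotallyDisconnectedSpace D] {φ : C → ℝ} {ψ : D → ℝ}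

/-- The basic move of the back-and-forth: cut from `V` a counterpart `W` of `U'` with nearly the
same ratio of suprema. The rest of `V` keeps the supremum, so it can serve as the counterpart of a
piece of `U` on which `φ` attains its maximum. -/
lemma exists_clopen_logSup_near (hφ : IsLelekFunction φ) (hψ : IsLelekFunction ψ)
    {U U' : Set C} (hU : IsClopen U) (hU' : IsClopen U') (hsub : U' ⊆ U) (hne : U'.Nonempty)
    {V : Set D} (hV : IsClopen V) (hVne : V.Nonempty) {δ : ℝ} (hδ : 0 < δ) :
    ∃ W : Set D, IsClopen W ∧ W ⊆ V ∧ W.Nonempty ∧ (V \ W).Nonempty ∧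
      logSup ψ (V \ W) = logSup ψ V ∧
      |(logSup ψ W - logSup φ U') - (logSup ψ V - logSup φ U)| ≤ δ := by
  obtain ⟨y, hyV, hy, hy0⟩ := hψ.exists_eq_sSup hV hVne
  have h1 := hφ.sSup_pos hU' hne
  have h2 := hφ.sSup_pos hU (hne.mono hsub)
  have h12 := hφ.sSup_mono hsub hne
  have h3 := hψ.sSup_pos hV hVne
  -- The supremum `W` would have if the ratio were preserved exactly. A clopen set on which `ψ < s`
  -- misses the maximum point `y`, and a value just below `s` makes the error at most `δ`.
  set s := sSup (φ '' U') * sSup (ψ '' V) / sSup (φ '' U) with hs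
  have hs0 : 0 < s := by positivity
  have hsV : s ≤ ψ y := by
    rw [hy, hs, div_le_iff₀ h2, mul_comm]
    exact mul_le_mul_of_nonneg_left h12 h3.le
  have hlog : Real.log s = logSup φ U' + logSup ψ V - logSup φ U := by
    rw [hs, Real.log_div (by positivity) h2.ne', Real.log_mul h1.ne' h3.ne']; rfl
  have hlt : s * Real.exp (-δ) < s := by
    have : Real.exp (-δ) < 1 := by simpa using hδ
    nlinarith
  obtain ⟨z, hzV, hz1, hz2⟩ := hψ.exists_between V hV.2 y hyV _ _ (by positivity) hlt hsV
  have hopen : IsOpen (V ∩ ψ ⁻¹' Iio s) := hV.2.inter (hψ.usc.isOpen_preimage s)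
  obtain ⟨W, hW, hzW, hWsub⟩ := compact_exists_isClopen_in_isOpen hopen ⟨hzV, hz2⟩
  have hyW : y ∉ W := fun h => absurd (hWsub h).2 (not_lt.2 hsV)
  refine ⟨W, hW, fun w hw => (hWsub hw).1, ⟨z, hzW⟩, ⟨y, hyV, hyW⟩, ?_, ?_⟩
  · unfold logSup
    congr 1
    refine le_antisymm (hψ.sSup_mono sdiff_subset ⟨y, hyV, hyW⟩) ?_
    rw [← hy]
    exact hψ.le_sSup ⟨hyV, hyW⟩
  · have hWs : sSup (ψ '' W) ≤ s := by
      refine csSup_le ⟨_, z, hzW, rfl⟩ ?_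
      rintro _ ⟨w, hw, rfl⟩
      exact (hWsub hw).2.le
    have hWz : s * Real.exp (-δ) ≤ sSup (ψ '' W) := hz1.le.trans (hψ.le_sSup hzW)
    have hW0 : 0 < sSup (ψ '' W) := hψ.sSup_pos hW ⟨z, hzW⟩
    have e1 : logSup ψ W ≤ Real.log s := Real.log_le_log hW0 hWs
    have e2 : Real.log s - δ ≤ logSup ψ W := by
      have := Real.log_le_log (by positivity) hWz
      rwa [Real.log_mul hs0.ne' (Real.exp_pos _).ne', Real.log_exp, ← sub_eq_add_neg] at this
    rw [abs_le]
    constructor <;> linarith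

/-- One of the two pieces of `U` contains a maximum point of `φ` and so keeps its supremum. It is
matched with the piece of `V` that keeps the supremum of `ψ`, the other one with the adjustable
piece. -/
lemma exists_clopen_split (hφ : IsLelekFunction φ) (hψ : IsLelekFunction ψ)
    {U A : Set C} (hU : IsClopen U) (hA : IsClopen A) {V : Set D} (hV : IsClopen V)
    (hUV : U.Nonempty ↔ V.Nonempty) {δ : ℝ} (hδ : 0 < δ) :
    ∃ B : Set D, IsClopen B ∧ ((U ∩ A).Nonempty ↔ (V ∩ B).Nonempty) ∧
      ((U \ A).Nonempty ↔ (V \ B).Nonempty) ∧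
      ((U ∩ A).Nonempty →
        |(logSup ψ (V ∩ B) - logSup φ (U ∩ A)) - (logSup ψ V - logSup φ U)| ≤ δ) ∧
      ((U \ A).Nonempty →
        |(logSup ψ (V \ B) - logSup φ (U \ A)) - (logSup ψ V - logSup φ U)| ≤ δ) := by
  by_cases h1 : (U ∩ A).Nonempty
  swap
  · have h : U \ A = U := by
      rw [sdiff_eq_left, disjoint_iff_inter_eq_empty]; exact not_nonempty_iff_eq_empty.1 h1
    refine ⟨∅, isClopen_empty, by simp [h1], by simp [h, hUV], fun h => absurd h h1, fun _ => ?_⟩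
    rw [h]; simp [hδ.le]
  by_cases h2 : (U \ A).Nonempty
  swap
  · have h : U ∩ A = U := by
      rw [inter_eq_left, ← sdiff_eq_empty]; exact not_nonempty_iff_eq_empty.1 h2
    refine ⟨univ, isClopen_univ, by simp [h, hUV], by simp [h2], fun _ => ?_, fun h => absurd h h2⟩
    rw [h]; simp [hδ.le]
  have hVne := hUV.1 (h1.mono inter_subset_left)
  obtain ⟨y, hyU, hy, -⟩ := hφ.exists_eq_sSup hU (h1.mono inter_subset_left)
  by_cases hyA : y ∈ A
  · obtain ⟨W, hW, hWV, hWne, hVW, e1, e2⟩ := exists_clopen_logSup_near hφ hψ hU (hU.diff hA)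
      sdiff_subset h2 hV hVne hδ
    have hs : V ∩ Wᶜ = V \ W := rfl
    have hs' : V \ Wᶜ = W := by rw [sdiff_compl, inter_eq_right]; exact hWV
    have e3 : logSup φ (U ∩ A) = logSup φ U := by
      unfold logSup
      congr 1
      exact le_antisymm (hφ.sSup_mono inter_subset_left h1) (hy ▸ hφ.le_sSup ⟨hyU, hyA⟩)
    refine ⟨Wᶜ, hW.compl, by simp [h1, hs, hVW], by simp [h2, hs', hWne], fun _ => ?_, fun _ => ?_⟩
    · rw [hs, e1, e3]; simp [hδ.le]
    · rwa [hs']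
  · obtain ⟨W, hW, hWV, hWne, hVW, e1, e2⟩ := exists_clopen_logSup_near hφ hψ hU (hU.inter hA)
      inter_subset_left h1 hV hVne hδ
    have hs' : V ∩ W = W := by rw [inter_eq_right]; exact hWV
    have e3 : logSup φ (U \ A) = logSup φ U := by
      unfold logSup
      congr 1
      exact le_antisymm (hφ.sSup_mono sdiff_subset h2) (hy ▸ hφ.le_sSup ⟨hyU, hyA⟩)
    refine ⟨W, hW, by simp [h1, hs', hWne], by simp [h2, hVW], fun _ => ?_, fun _ => ?_⟩
    · rwa [hs']
    · rw [e1, e3]; simp [hδ.le]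

end LelekFunctions

/-! ### Matched clopen partitions, encoded by labels in `ℕ`, and their refinement. -/

section Labellings

/-- A pair of continuous labellings with the same labels: a matching of a clopen partition of `C`
with a clopen partition of `D`. -/
structure IsMatching {C D : Type*} [TopologicalSpace C] [TopologicalSpace D]
    (f : C → ℕ) (g : D → ℕ) : Prop where
  cont_left : Continuous f
  cont_right : Continuous g
  range_eq : range f = range g

lemma IsMatching.symm {C D : Type*} [TopologicalSpace C] [TopologicalSpace D]
    {f : C → ℕ} {g : D → ℕ} (h : IsMatching f g) : IsMatching g f :=
  ⟨h.cont_right, h.cont_left, h.range_eq.symm⟩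

/-- The logarithmic ratio of the suprema of `ψ` and `φ` on the sets with label `i`. -/
noncomputable def logRatio {C D : Type*} (φ : C → ℝ) (ψ : D → ℝ) (f : C → ℕ) (g : D → ℕ)
    (i : ℕ) : ℝ :=
  logSup ψ (g ⁻¹' {i}) - logSup φ (f ⁻¹' {i})

lemma logRatio_swap {C D : Type*} (φ : C → ℝ) (ψ : D → ℝ) (f : C → ℕ) (g : D → ℕ) (i : ℕ) :
    logRatio ψ φ g f i = - logRatio φ ψ f g i := by
  simp [logRatio]

/-- The matching `(f', g')` refines `(f, g)` and changes the logarithmic ratios by at most `δ`. -/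
structure IsRefinement {C D : Type*} [TopologicalSpace C] [TopologicalSpace D]
    (φ : C → ℝ) (ψ : D → ℝ) (f : C → ℕ) (g : D → ℕ) (f' : C → ℕ) (g' : D → ℕ) (δ : ℝ) :
    Prop where
  left : ∀ x x', f' x = f' x' → f x = f x'
  right : ∀ y y', g' y = g' y' → g y = g y'
  mixed : ∀ x y, f' x = g' y → f x = g y
  ratio : ∀ x y, f' x = g' y → |logRatio φ ψ f' g' (f' x) - logRatio φ ψ f g (f x)| ≤ δ

open Classical in
/-- Splitting every set of a labelling into its parts inside and outside of `A`. -/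
noncomputable def splitLabel {C : Type*} (f : C → ℕ) (A : Set C) (x : C) : ℕ :=
  2 * f x + if x ∈ A then 1 else 0

lemma splitLabel_preimage_odd {C : Type*} (f : C → ℕ) (A : Set C) (i : ℕ) :
    splitLabel f A ⁻¹' {2 * i + 1} = f ⁻¹' {i} ∩ A := by
  ext x
  by_cases hx : x ∈ A <;> simp [splitLabel, hx]
  omega

lemma splitLabel_preimage_even {C : Type*} (f : C → ℕ) (A : Set C) (i : ℕ) :
    splitLabel f A ⁻¹' {2 * i} = f ⁻¹' {i} \ A := by
  ext x
  by_cases hx : x ∈ A <;> simp [splitLabel, hx]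
  omega

lemma splitLabel_div {C : Type*} (f : C → ℕ) (A : Set C) (x : C) : splitLabel f A x / 2 = f x := by
  unfold splitLabel; split_ifs <;> omega

lemma splitLabel_mem {C : Type*} (f : C → ℕ) (A : Set C) {x x' : C} (h : splitLabel f A x = splitLabel f A x') :
    x ∈ A ↔ x' ∈ A := by
  unfold splitLabel at h; split_ifs at h <;> simp_all <;> omega

section

variable {C D : Type*} [TopologicalSpace C] [TopologicalSpace D] {φ : C → ℝ} {ψ : D → ℝ}
  {f f' f'' : C → ℕ} {g g' g'' : D → ℕ} {δ δ' : ℝ}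

lemma IsRefinement.symm (h : IsRefinement φ ψ f g f' g' δ) : IsRefinement ψ φ g f g' f' δ := by
  refine ⟨h.right, h.left, fun y x e => (h.mixed x y e.symm).symm, fun y x e => ?_⟩
  rw [← h.mixed x y e.symm, e, ← abs_neg]
  convert h.ratio x y e.symm using 2
  rw [logRatio_swap φ ψ f' g', logRatio_swap φ ψ f g]
  ring

lemma IsRefinement.trans (h : IsRefinement φ ψ f g f' g' δ)
    (h' : IsRefinement φ ψ f' g' f'' g'' δ') : IsRefinement φ ψ f g f'' g'' (δ + δ') := by
  refine ⟨fun x x' e => h.left _ _ (h'.left _ _ e), fun x x' e => h.right _ _ (h'.right _ _ e),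
    fun x x' e => h.mixed _ _ (h'.mixed _ _ e), fun x y e => ?_⟩
  have h1 := h.ratio x y (h'.mixed x y e)
  have h2 := h'.ratio x y e
  rw [abs_le] at *
  constructor <;> linarith

lemma continuous_splitLabel (hf : Continuous f) {A : Set C} (hA : IsClopen A) :
    Continuous (splitLabel f A) := by
  rw [continuous_discrete_rng]
  intro n
  have hfi : ∀ i, IsClopen (f ⁻¹' {i}) := fun i => (isClopen_discrete {i}).preimage hf
  obtain ⟨i, rfl | rfl⟩ := n.even_or_odd'
  · rw [splitLabel_preimage_even]; exact ((hfi i).diff hA).2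
  · rw [splitLabel_preimage_odd]; exact ((hfi i).inter hA).2

lemma mem_range_iff_preimage_nonempty {α β : Type*} (f : α → β) (b : β) :
    b ∈ range f ↔ (f ⁻¹' {b}).Nonempty := Iff.rfl

variable [CompactSpace C] [CompactSpace D]

lemma IsMatching.exists_refinement_left [T2Space D] [TotallyDisconnectedSpace D]
    (hφ : IsLelekFunction φ) (hψ : IsLelekFunction ψ)
    (h : IsMatching f g) {A : Set C} (hA : IsClopen A) (hδ : 0 < δ) :
    ∃ f' g', IsMatching f' g' ∧ IsRefinement φ ψ f g f' g' δ ∧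
      ∀ x x', f' x = f' x' → (x ∈ A ↔ x' ∈ A) := by
  have hfi : ∀ i, IsClopen (f ⁻¹' {i}) := fun i => (isClopen_discrete {i}).preimage h.cont_left
  have hgi : ∀ i, IsClopen (g ⁻¹' {i}) := fun i => (isClopen_discrete {i}).preimage h.cont_right
  have hne : ∀ i, (f ⁻¹' {i}).Nonempty ↔ (g ⁻¹' {i}).Nonempty := fun i => by
    rw [← mem_range_iff_preimage_nonempty, ← mem_range_iff_preimage_nonempty, h.range_eq]
  choose B hB hB1 hB2 hB3 hB4 using fun i => exists_clopen_split hφ hψ (hfi i) hA (hgi i) (hne i) hδ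
  -- The sets `B i`, chosen separately for each label, are glued into one set; it is clopen because
  -- the fibres of `g` are.
  set B' : Set D := {y | y ∈ B (g y)} with hB'
  have e1 : ∀ i, g ⁻¹' {i} ∩ B' = g ⁻¹' {i} ∩ B i := fun i => by
    ext y; simp only [mem_inter_iff, mem_preimage, mem_singleton_iff, hB', mem_ofPred_eq]
    constructor <;> rintro ⟨rfl, h⟩ <;> exact ⟨rfl, h⟩
  have e2 : ∀ i, g ⁻¹' {i} \ B' = g ⁻¹' {i} \ B i := fun i => by
    ext y; simp only [mem_sdiff, mem_preimage, mem_singleton_iff, hB', mem_ofPred_eq]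
    constructor <;> rintro ⟨rfl, h⟩ <;> exact ⟨rfl, h⟩
  have hB'c : IsClopen B' := by
    constructor
    · rw [← isOpen_compl_iff]
      have : B'ᶜ = ⋃ i, g ⁻¹' {i} \ B i := by
        ext y; simp [hB']
      rw [this]
      exact isOpen_iUnion fun i => ((hgi i).diff (hB i)).2
    · have : B' = ⋃ i, g ⁻¹' {i} ∩ B i := by
        ext y; simp [hB']
      rw [this]
      exact isOpen_iUnion fun i => ((hgi i).inter (hB i)).2
  refine ⟨splitLabel f A, splitLabel g B', ⟨continuous_splitLabel h.cont_left hA,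
    continuous_splitLabel h.cont_right hB'c, ?_⟩, ⟨?_, ?_, ?_, ?_⟩, fun x x' => splitLabel_mem f A⟩
  · ext n
    rw [mem_range_iff_preimage_nonempty, mem_range_iff_preimage_nonempty]
    obtain ⟨i, rfl | rfl⟩ := n.even_or_odd'
    · rw [splitLabel_preimage_even, splitLabel_preimage_even, e2, hB2]
    · rw [splitLabel_preimage_odd, splitLabel_preimage_odd, e1, hB1]
  · intro x x' e
    rw [← splitLabel_div f A, e, splitLabel_div]
  · intro x x' e
    rw [← splitLabel_div g B', e, splitLabel_div]
  · intro x y e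
    rw [← splitLabel_div f A, e, splitLabel_div]
  · intro x y _
    obtain ⟨i, hi | hi⟩ := (splitLabel f A x).even_or_odd'
    · have hfx : f x = i := by rw [← splitLabel_div f A, hi]; omega
      have hx : x ∈ splitLabel f A ⁻¹' {2 * i} := hi
      rw [hi, hfx]
      rw [splitLabel_preimage_even] at hx
      unfold logRatio
      rw [splitLabel_preimage_even, splitLabel_preimage_even, e2]
      exact hB4 i ⟨x, hx⟩
    · have hfx : f x = i := by rw [← splitLabel_div f A, hi]; omega
      have hx : x ∈ splitLabel f A ⁻¹' {2 * i + 1} := hi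
      rw [hi, hfx]
      rw [splitLabel_preimage_odd] at hx
      unfold logRatio
      rw [splitLabel_preimage_odd, splitLabel_preimage_odd, e1]
      exact hB3 i ⟨x, hx⟩

/-- The "forth" step for `A` is followed by the "back" step for `B`, which is the forth step of the
swapped matching; each uses half of `δ`. -/
lemma IsMatching.exists_refinement [T2Space C] [TotallyDisconnectedSpace C]
    [T2Space D] [TotallyDisconnectedSpace D]
    (hφ : IsLelekFunction φ) (hψ : IsLelekFunction ψ)
    (h : IsMatching f g) {A : Set C} (hA : IsClopen A) {B : Set D} (hB : IsClopen B)
    (hδ : 0 < δ) :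
    ∃ f' g', IsMatching f' g' ∧ IsRefinement φ ψ f g f' g' δ ∧
      (∀ x x', f' x = f' x' → (x ∈ A ↔ x' ∈ A)) ∧ ∀ y y', g' y = g' y' → (y ∈ B ↔ y' ∈ B) := by
  obtain ⟨f₁, g₁, m₁, r₁, h₁⟩ := h.exists_refinement_left hφ hψ hA (half_pos hδ)
  obtain ⟨g₂, f₂, m₂, r₂, h₂⟩ := m₁.symm.exists_refinement_left hψ hφ hB (half_pos hδ)
  refine ⟨f₂, g₂, m₂.symm, ?_, fun x x' e => h₁ _ _ (r₂.symm.left _ _ e), h₂⟩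
  have := r₁.trans r₂.symm
  rwa [add_halves] at this

end

end Labellings

/-! ### Uniqueness of Lelek functions up to homeomorphism and a positive factor. -/

section Uniqueness

open Filter

/-- The fibre through `x` eventually lies in any given clopen neighbourhood of `x`, and upper
semicontinuity bounds `φ` there. -/
lemma IsLelekFunction.tendsto_sSup_fibre {C : Type*} [TopologicalSpace C] [CompactSpace C]
    [T2Space C] [TotallyDisconnectedSpace C] {φ : C → ℝ} (hφ : IsLelekFunction φ)
    {F : ℕ → C → ℕ}
    (hF : ∀ A : Set C, IsClopen A → ∃ N, ∀ n ≥ N, ∀ x x', F n x = F n x' → (x ∈ A ↔ x' ∈ A))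
    (x : C) : Tendsto (fun n => sSup (φ '' (F n ⁻¹' {F n x}))) atTop (𝓝 (φ x)) := by
  rw [Metric.tendsto_atTop]
  intro ε hε
  obtain ⟨A, hA, hxA, hAsub⟩ := compact_exists_isClopen_in_isOpen
    (hφ.usc.isOpen_preimage (φ x + ε / 2)) (show x ∈ φ ⁻¹' Iio (φ x + ε / 2) by simp [hε])
  obtain ⟨N, hN⟩ := hF A hA
  refine ⟨N, fun n hn => ?_⟩
  have h1 : φ x ≤ sSup (φ '' (F n ⁻¹' {F n x})) := hφ.le_sSup rfl
  have h2 : sSup (φ '' (F n ⁻¹' {F n x})) ≤ φ x + ε / 2 := by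
    refine csSup_le ⟨_, x, rfl, rfl⟩ ?_
    rintro _ ⟨y, hy, rfl⟩
    exact (show φ y < φ x + ε / 2 from hAsub ((hN n hn y x hy).2 hxA)).le
  rw [Real.dist_eq, abs_lt]
  constructor <;> linarith

/-- A sequence of refining matchings whose labels separate points induces a homeomorphism. -/
lemma exists_homeomorph_of_matchings {C D : Type*} [TopologicalSpace C] [TopologicalSpace D]
    [CompactSpace C] [CompactSpace D] [T2Space C] [T2Space D] [TotallyDisconnectedSpace C]
    [TotallyDisconnectedSpace D] {F : ℕ → C → ℕ} {G : ℕ → D → ℕ}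
    (hm : ∀ n, IsMatching (F n) (G n))
    (hr : ∀ n x y, F (n + 1) x = G (n + 1) y → F n x = G n y)
    (hF : ∀ A : Set C, IsClopen A → ∃ N, ∀ n ≥ N, ∀ x x', F n x = F n x' → (x ∈ A ↔ x' ∈ A))
    (hG : ∀ B : Set D, IsClopen B → ∃ N, ∀ n ≥ N, ∀ y y', G n y = G n y' → (y ∈ B ↔ y' ∈ B)) :
    ∃ h : C ≃ₜ D, ∀ n x, F n x = G n (h x) := by
  -- The fibres of `G n` with the labels of `x` form a decreasing sequence of non-empty compact
  -- sets.
  have exD : ∀ x, ∃ y, ∀ n, F n x = G n y := by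
    intro x
    have hcl : ∀ n, IsClosed (G n ⁻¹' {F n x}) := fun n =>
      isClosed_singleton.preimage (hm n).cont_right
    have := IsCompact.nonempty_iInter_of_sequence_nonempty_isCompact_isClosed
      (fun n => G n ⁻¹' {F n x}) (fun n y hy => (hr n x y hy.symm).symm)
      (fun n => by
        obtain ⟨y, hy⟩ : F n x ∈ range (G n) := (hm n).range_eq ▸ mem_range_self x
        exact ⟨y, hy⟩) (hcl 0).isCompact hcl
    obtain ⟨y, hy⟩ := this
    exact ⟨y, fun n => (mem_iInter.1 hy n).symm⟩
  have exC : ∀ y, ∃ x, ∀ n, F n x = G n y := by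
    intro y
    have hcl : ∀ n, IsClosed (F n ⁻¹' {G n y}) := fun n =>
      isClosed_singleton.preimage (hm n).cont_left
    have := IsCompact.nonempty_iInter_of_sequence_nonempty_isCompact_isClosed
      (fun n => F n ⁻¹' {G n y}) (fun n x hx => hr n x y hx)
      (fun n => by
        obtain ⟨x, hx⟩ : G n y ∈ range (F n) := (hm n).range_eq ▸ mem_range_self y
        exact ⟨x, hx⟩) (hcl 0).isCompact hcl
    obtain ⟨x, hx⟩ := this
    exact ⟨x, fun n => mem_iInter.1 hx n⟩
  have uniqC : ∀ x x', (∀ n, F n x = F n x') → x = x' := by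
    intro x x' h
    by_contra hne
    obtain ⟨A, hA, hx, hx'⟩ := exists_isClopen_of_totally_separated hne
    obtain ⟨N, hN⟩ := hF A hA
    exact hx' ((hN N le_rfl x x' (h N)).1 hx)
  have uniqD : ∀ y y', (∀ n, G n y = G n y') → y = y' := by
    intro y y' h
    by_contra hne
    obtain ⟨A, hA, hy, hy'⟩ := exists_isClopen_of_totally_separated hne
    obtain ⟨N, hN⟩ := hG A hA
    exact hy' ((hN N le_rfl y y' (h N)).1 hy)
  choose h hh using exD
  choose k hk using exC
  let e : C ≃ D :=
    { toFun := h
      invFun := k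
      left_inv := fun x => uniqC _ _ fun n => by rw [hk, ← hh]
      right_inv := fun y => uniqD _ _ fun n => by rw [← hh, hk] }
  have hc : Continuous e := by
    rw [isTopologicalBasis_isClopen.continuous_iff]
    intro B hB
    obtain ⟨N, hN⟩ := hG B hB
    have : e ⁻¹' B = F N ⁻¹' (G N '' B) := by
      ext x
      constructor
      · intro hx
        exact ⟨h x, hx, (hh x N).symm⟩
      · rintro ⟨y, hy, e⟩
        exact (hN N le_rfl y (h x) (e.trans (hh x N))).1 hy
    rw [this]
    exact (isOpen_discrete _).preimage (hm N).cont_left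
  exact ⟨hc.homeoOfEquivCompactToT2, fun n x => hh x n⟩

/-- Both countable families of clopen sets are handled in turn, with errors `1 / 2 / 2 ^ n`. The
logarithmic ratios are locally constant and converge uniformly, so the exponential of their limit is
a continuous positive factor `α`. -/
theorem IsLelekFunction.exists_homeomorph {C D : Type*} [TopologicalSpace C] [TopologicalSpace D]
    [CompactSpace C] [CompactSpace D] [T2Space C] [T2Space D] [TotallyDisconnectedSpace C]
    [TotallyDisconnectedSpace D] [SecondCountableTopology C] [SecondCountableTopology D]
    [Nonempty C] [Nonempty D]
    {φ : C → ℝ} {ψ : D → ℝ} (hφ : IsLelekFunction φ) (hψ : IsLelekFunction ψ) :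
    ∃ (h : C ≃ₜ D) (α : C → ℝ), Continuous α ∧ (∀ x, 0 < α x) ∧ ∀ x, ψ (h x) = α x * φ x := by
  have := TopologicalSpace.Clopens.countable_iff_secondCountable.2
    ‹SecondCountableTopology C›
  have := TopologicalSpace.Clopens.countable_iff_secondCountable.2
    ‹SecondCountableTopology D›
  obtain ⟨A, hA⟩ := exists_surjective_nat (TopologicalSpace.Clopens C)
  obtain ⟨B, hB⟩ := exists_surjective_nat (TopologicalSpace.Clopens D)
  have step : ∀ (n : ℕ) (s : {p : (C → ℕ) × (D → ℕ) // IsMatching p.1 p.2}),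
      ∃ t : {p : (C → ℕ) × (D → ℕ) // IsMatching p.1 p.2},
        IsRefinement φ ψ s.1.1 s.1.2 t.1.1 t.1.2 (1 / 2 / 2 ^ n) ∧
        (∀ x x', t.1.1 x = t.1.1 x' → (x ∈ A n ↔ x' ∈ A n)) ∧
        ∀ y y', t.1.2 y = t.1.2 y' → (y ∈ B n ↔ y' ∈ B n) := by
    rintro n ⟨⟨f, g⟩, h⟩
    obtain ⟨f', g', h1, h2, h3, h4⟩ := h.exists_refinement hφ hψ (A n).isClopen (B n).isClopen
      (show (0 : ℝ) < 1 / 2 / 2 ^ n by positivity)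
    exact ⟨⟨⟨f', g'⟩, h1⟩, h2, h3, h4⟩
  choose next hn1 hn2 hn3 using step
  let s₀ : {p : (C → ℕ) × (D → ℕ) // IsMatching p.1 p.2} :=
    ⟨⟨fun _ => 0, fun _ => 0⟩, continuous_const, continuous_const, by simp⟩
  let S : ℕ → {p : (C → ℕ) × (D → ℕ) // IsMatching p.1 p.2} := fun n => Nat.rec s₀ next n
  let F : ℕ → C → ℕ := fun n => (S n).1.1
  let G : ℕ → D → ℕ := fun n => (S n).1.2
  have hm : ∀ n, IsMatching (F n) (G n) := fun n => (S n).2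
  have hr : ∀ n, IsRefinement φ ψ (F n) (G n) (F (n + 1)) (G (n + 1)) (1 / 2 / 2 ^ n) :=
    fun n => hn1 n (S n)
  have hFl : ∀ N n, N ≤ n → ∀ x x', F n x = F n x' → F N x = F N x' := by
    intro N n h
    induction n, h using Nat.le_induction with
    | base => exact fun x x' e => e
    | succ n _ ih => exact fun x x' e => ih x x' ((hr n).left x x' e)
  have hGl : ∀ N n, N ≤ n → ∀ x x', G n x = G n x' → G N x = G N x' := by
    intro N n h
    induction n, h using Nat.le_induction with
    | base => exact fun x x' e => e
    | succ n _ ih => exact fun x x' e => ih x x' ((hr n).right x x' e)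
  have hF : ∀ A : Set C, IsClopen A →
      ∃ N, ∀ n ≥ N, ∀ x x', F n x = F n x' → (x ∈ A ↔ x' ∈ A) := by
    intro A' hA'
    obtain ⟨m, hm⟩ := hA ⟨A', hA'⟩
    refine ⟨m + 1, fun n hn x x' e => ?_⟩
    have := hn2 m (S m) x x' (hFl _ _ hn x x' e)
    rwa [hm] at this
  have hG : ∀ B : Set D, IsClopen B →
      ∃ N, ∀ n ≥ N, ∀ x x', G n x = G n x' → (x ∈ B ↔ x' ∈ B) := by
    intro B' hB'
    obtain ⟨m, hm⟩ := hB ⟨B', hB'⟩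
    refine ⟨m + 1, fun n hn x x' e => ?_⟩
    have := hn3 m (S m) x x' (hGl _ _ hn x x' e)
    rwa [hm] at this
  obtain ⟨h, hh⟩ := exists_homeomorph_of_matchings hm (fun n => (hr n).mixed) hF hG
  let a : ℕ → C → ℝ := fun n x => logRatio φ ψ (F n) (G n) (F n x)
  have hacont : ∀ n, Continuous (a n) := fun n =>
    (continuous_of_discreteTopology (f := logRatio φ ψ (F n) (G n))).comp (hm n).cont_left
  have hdist : ∀ x n, dist (a n x) (a (n + 1) x) ≤ 1 / 2 / 2 ^ n := by
    intro x n
    rw [dist_comm]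
    exact (hr n).ratio x (h x) (hh (n + 1) x)
  choose L hL using fun x => cauchySeq_tendsto_of_complete (cauchySeq_of_le_geometric_two (hdist x))
  have hLd : ∀ x n, dist (a n x) (L x) ≤ 1 / 2 ^ n := fun x n =>
    dist_le_of_le_geometric_two_of_tendsto (hdist x) (hL x) n
  have hLc : Continuous L := by
    have hu : TendstoUniformly a L atTop := by
      rw [Metric.tendstoUniformly_iff]
      intro ε hε
      have : Tendsto (fun n : ℕ => (1 : ℝ) / 2 ^ n) atTop (𝓝 0) := by
        simpa using tendsto_pow_atTop_nhds_zero_of_lt_one (r := (1 / 2 : ℝ)) (by norm_num)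
          (by norm_num)
      filter_upwards [this.eventually (gt_mem_nhds hε)] with n hn x
      rw [dist_comm]
      exact (hLd x n).trans_lt hn
    exact hu.continuous (Frequently.of_forall hacont)
  refine ⟨h, fun x => Real.exp (L x), Real.continuous_exp.comp hLc, fun x => Real.exp_pos _,
    fun x => ?_⟩
  -- At each stage the supremum of `ψ` on a fibre is `exp (a n x)` times that of `φ` on the matching
  -- fibre. Passing to the limit also covers the points with `φ x = 0`.
  have t1 := hψ.tendsto_sSup_fibre hG (h x)
  have t2 := ((Real.continuous_exp.tendsto _).comp (hL x)).mul (hφ.tendsto_sSup_fibre hF x)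
  refine tendsto_nhds_unique (t1.congr fun n => ?_) t2
  have p1 : 0 < sSup (φ '' (F n ⁻¹' {F n x})) :=
    hφ.sSup_pos ((isClopen_discrete _).preimage (hm n).cont_left) ⟨x, rfl⟩
  have p2 : 0 < sSup (ψ '' (G n ⁻¹' {F n x})) :=
    hψ.sSup_pos ((isClopen_discrete _).preimage (hm n).cont_right) ⟨h x, (hh n x).symm⟩
  simp only [Function.comp_apply, a, logRatio, logSup, ← hh n x]
  rw [Real.exp_sub, Real.exp_log p1, Real.exp_log p2, div_mul_cancel₀ _ p1.ne']

end Uniqueness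

/-! ### Leg coordinates, end-points and ramification points. -/

section LocalCoordinates

variable {X K : Type*} [TopologicalSpace X] [TopologicalSpace K]

/-- Injective continuous coordinates `(κ, τ)` on an open set `U`, where `κ` takes its values in a
totally disconnected set. -/
structure IsLegCoordinates (U : Set X) (S : Set K) (κ : X → K) (τ : X → ℝ) : Prop where
  isOpen : IsOpen U
  totallyDisconnected : IsTotallyDisconnected S
  mapsTo : MapsTo κ U S
  continuousOn_fst : ContinuousOn κ U
  continuousOn_snd : ContinuousOn τ U
  injective : ∀ x ∈ U, ∀ y ∈ U, κ x = κ y → τ x = τ y → x = y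

variable {U : Set X} {S : Set K} {κ : X → K} {τ : X → ℝ}

/-- A path cannot change its leg, because `κ` takes values in a totally disconnected set; hence `τ`
alone separates its points. -/
lemma IsLegCoordinates.restrict_path (hc : IsLegCoordinates U S κ τ) {γ : ℝ → X}
    (hγ : Continuous γ) {a b : ℝ} (hinj : InjOn γ (Icc a b)) (hU : MapsTo γ (Icc a b) U) :
    (∀ s ∈ Icc a b, ∀ t ∈ Icc a b, κ (γ s) = κ (γ t)) ∧ ContinuousOn (τ ∘ γ) (Icc a b) ∧
      InjOn (τ ∘ γ) (Icc a b) := by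
  have h1 : ∀ s ∈ Icc a b, ∀ t ∈ Icc a b, κ (γ s) = κ (γ t) := by
    intro s hs t ht
    have hp : IsPreconnected ((κ ∘ γ) '' Icc a b) :=
      isPreconnected_Icc.image _ (hc.continuousOn_fst.comp hγ.continuousOn hU)
    refine hc.totallyDisconnected _ ?_ hp ⟨s, hs, rfl⟩ ⟨t, ht, rfl⟩
    rintro _ ⟨u, hu, rfl⟩
    exact hc.mapsTo (hU hu)
  exact ⟨h1, hc.continuousOn_snd.comp hγ.continuousOn hU,
    fun s hs t ht e => hinj hs ht (hc.injective _ (hU hs) _ (hU ht) (h1 s hs t ht) e)⟩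

lemma exists_real_path_of_isArcBetween {A : Set X} {a b : X} (h : IsArcBetween A a b) :
    ∃ γ : ℝ → X, Continuous γ ∧ InjOn γ (Icc 0 1) ∧ γ '' Icc 0 1 = A ∧ γ 0 = a ∧ γ 1 = b := by
  obtain ⟨γ, hγ, rfl, rfl, rfl⟩ := h
  refine ⟨IccExtend zero_le_one γ, hγ.continuous.Icc_extend', ?_, ?_, ?_, ?_⟩
  · intro s hs t ht e
    rw [IccExtend_of_mem _ _ hs, IccExtend_of_mem _ _ ht] at e
    exact congrArg Subtype.val (hγ.injective e)
  · ext x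
    constructor
    · rintro ⟨s, hs, rfl⟩
      rw [IccExtend_of_mem _ _ hs]
      exact mem_range_self _
    · rintro ⟨s, rfl⟩
      exact ⟨s, s.2, IccExtend_of_mem _ _ s.2⟩
  · exact IccExtend_left _ _
  · exact IccExtend_right _ _

/-- Along an arc through `x` in its interior, `τ` would be strictly monotone near `x` on a single
leg, and so would exceed `τ x` on one side. -/
lemma IsLegCoordinates.mem_endPointSet (hc : IsLegCoordinates U S κ τ) {x : X} (hx : x ∈ U)
    (hmax : ∀ y ∈ U, κ y = κ x → τ y ≤ τ x) : x ∈ endPointSet X := by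
  intro A a b hA hxA
  obtain ⟨γ, hγ, hinj, rfl, rfl, rfl⟩ := exists_real_path_of_isArcBetween hA
  obtain ⟨s, hs, rfl⟩ := hxA
  by_contra! hne
  have hs0 : 0 < s := lt_of_le_of_ne hs.1 fun h => hne.1 (by rw [← h])
  have hs1 : s < 1 := lt_of_le_of_ne hs.2 fun h => hne.2 (by rw [← h])
  have hnhds : γ ⁻¹' U ∩ Ioo 0 1 ∈ 𝓝 s :=
    ((hc.isOpen.preimage hγ).inter isOpen_Ioo).mem_nhds ⟨hx, hs0, hs1⟩
  obtain ⟨ε, hε, hball⟩ := Metric.nhds_basis_closedBall.mem_iff.1 hnhds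
  rw [Real.closedBall_eq_Icc] at hball
  obtain ⟨h1, h2, h3⟩ := hc.restrict_path hγ
    (hinj.mono fun t ht => Ioo_subset_Icc_self (hball ht).2) fun t ht => (hball ht).1
  have ms : s ∈ Icc (s - ε) (s + ε) := ⟨by linarith, by linarith⟩
  have ml : s - ε ∈ Icc (s - ε) (s + ε) := ⟨by linarith, by linarith⟩
  have mr : s + ε ∈ Icc (s - ε) (s + ε) := ⟨by linarith, by linarith⟩
  rcases h2.strictMonoOn_of_injOn_Icc' (by linarith) h3 with hm | hm
  · exact absurd (hm ms mr (by linarith)) (not_lt.2 (hmax _ (hball mr).1 (h1 _ mr _ ms)))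
  · exact absurd (hm ml ms (by linarith)) (not_lt.2 (hmax _ (hball ml).1 (h1 _ ml _ ms)))

lemma IsLegCoordinates.exists_uIcc_subset_arc (hc : IsLegCoordinates U S κ τ) {v : X} (hv : v ∈ U)
    {A : Set X} {b : X} (hA : IsArcBetween A v b) :
    ∃ t, t ≠ τ v ∧ ∀ y ∈ uIcc (τ v) t, ∃ x ∈ A, x ∈ U ∧ κ x = κ v ∧ τ x = y := by
  obtain ⟨γ, hγ, hinj, rfl, rfl, rfl⟩ := exists_real_path_of_isArcBetween hA
  have hnhds : γ ⁻¹' U ∈ 𝓝 0 := (hc.isOpen.preimage hγ).mem_nhds hv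
  obtain ⟨ε, hε, hball⟩ := Metric.nhds_basis_closedBall.mem_iff.1 hnhds
  rw [Real.closedBall_eq_Icc] at hball
  have hd0 : 0 < min ε 1 := lt_min hε one_pos
  have hsub : Icc 0 (min ε 1) ⊆ Icc (0 : ℝ) 1 := Icc_subset_Icc le_rfl (min_le_right _ _)
  have hUm : MapsTo γ (Icc 0 (min ε 1)) U := fun t ht =>
    hball ⟨by linarith [ht.1], by linarith [ht.2, min_le_left ε 1]⟩
  obtain ⟨h1, h2, h3⟩ := hc.restrict_path hγ (hinj.mono hsub) hUm
  have m0 : (0 : ℝ) ∈ Icc 0 (min ε 1) := ⟨le_rfl, hd0.le⟩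
  have m1 : min ε 1 ∈ Icc 0 (min ε 1) := ⟨hd0.le, le_rfl⟩
  refine ⟨τ (γ (min ε 1)), fun e => hd0.ne' (h3 m1 m0 e), fun y hy => ?_⟩
  rw [← uIcc_of_le hd0.le] at h2
  obtain ⟨s, hs, rfl⟩ := intermediate_value_uIcc h2 hy
  rw [uIcc_of_le hd0.le] at hs
  exact ⟨γ s, ⟨s, hsub hs, rfl⟩, hUm hs, h1 s hs 0 m0, rfl⟩

/-- A leg has only two directions at `v`, so two of any three arcs issuing from `v` start in the
same direction and overlap. -/
lemma IsLegCoordinates.not_isFanTop (hc : IsLegCoordinates U S κ τ) {v : X} (hv : v ∈ U) :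
    ¬ IsFanTop v := by
  rintro ⟨A, b, hA, hdisj⟩
  choose t ht hx using fun i => hc.exists_uIcc_subset_arc hv (hA i)
  obtain ⟨i, j, hij, hside⟩ := Fintype.exists_ne_map_eq_of_card_lt
    (fun i => decide (τ v < t i)) (by simp)
  have key : ∃ y, y ≠ τ v ∧ y ∈ uIcc (τ v) (t i) ∧ y ∈ uIcc (τ v) (t j) := by
    simp only [decide_eq_decide] at hside
    by_cases h : τ v < t i
    · have h' := hside.1 h
      rw [uIcc_of_le h.le, uIcc_of_le h'.le]
      exact ⟨min (t i) (t j), (lt_min h h').ne', ⟨(lt_min h h').le, min_le_left _ _⟩,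
        (lt_min h h').le, min_le_right _ _⟩
    · have h1 : t i < τ v := lt_of_le_of_ne (not_lt.1 h) (ht i)
      have h2 : t j < τ v := lt_of_le_of_ne (not_lt.1 (mt hside.2 h)) (ht j)
      rw [uIcc_of_ge h1.le, uIcc_of_ge h2.le]
      exact ⟨max (t i) (t j), (max_lt h1 h2).ne, ⟨le_max_left _ _, (max_lt h1 h2).le⟩,
        le_max_right _ _, (max_lt h1 h2).le⟩
  obtain ⟨y, hy, hyi, hyj⟩ := key
  obtain ⟨x, hxA, hxU, hxκ, rfl⟩ := hx i y hyi
  obtain ⟨x', hxA', hxU', hxκ', hτ⟩ := hx j _ hyj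
  obtain rfl := hc.injective _ hxU' _ hxU (hxκ'.trans hxκ.symm) hτ
  have : x' ∈ A i ∩ A j := ⟨hxA, hxA'⟩
  rw [hdisj i j hij, mem_singleton_iff] at this
  exact hy (by rw [this])

end LocalCoordinates

/-! ### Fans as collapsed regions under a function. -/

section FanParametrizations

/-- The region between `0` and the graph of `φ`. -/
abbrev SubgraphRegion {K : Type*} (φ : K → ℝ) : Type _ := {x : K × ℝ // 0 ≤ x.2 ∧ x.2 ≤ φ x.1}

/-- `p` presents `X` as the region below the graph of `φ` with the base collapsed to `v`. -/
structure IsFanParam {K X : Type*} [TopologicalSpace K] [TopologicalSpace X] (φ : K → ℝ)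
    (p : SubgraphRegion φ → X) (v : X) : Prop where
  continuous : Continuous p
  surjective : Function.Surjective p
  eq_top_iff : ∀ x, p x = v ↔ x.1.2 = 0
  eq_of_pos : ∀ x y, p x = p y → 0 < x.1.2 → x = y

variable {K X : Type*} [TopologicalSpace K] [TopologicalSpace X] {φ : K → ℝ}

lemma IsLelekFunction.compactSpace_region [CompactSpace K] (hφ : IsLelekFunction φ) :
    CompactSpace (SubgraphRegion φ) := by
  refine (isCompact_iff_compactSpace (s := {x : K × ℝ | 0 ≤ x.2 ∧ x.2 ≤ φ x.1})).1 ?_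
  refine (isCompact_univ.prod (isCompact_Icc (a := (0 : ℝ)) (b := 1))).of_isClosed_subset ?_
    fun x hx => ⟨mem_univ _, hx.1, hx.2.trans (hφ.le_one _)⟩
  exact (isClosed_le continuous_const continuous_snd).inter hφ.usc.IsClosed_hypograph

namespace IsFanParam

variable {p : SubgraphRegion φ → X} {v : X}

lemma eq_iff (hp : IsFanParam φ p v) (x y : SubgraphRegion φ) :
    p x = p y ↔ x = y ∨ (x.1.2 = 0 ∧ y.1.2 = 0) := by
  constructor
  · intro h
    rcases x.2.1.eq_or_lt with h0 | h0
    · exact Or.inr ⟨h0.symm, (hp.eq_top_iff y).1 (h ▸ (hp.eq_top_iff x).2 h0.symm)⟩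
    · exact Or.inl (hp.eq_of_pos x y h h0)
  · rintro (rfl | ⟨h1, h2⟩)
    · rfl
    · rw [(hp.eq_top_iff x).2 h1, (hp.eq_top_iff y).2 h2]

lemma compactSpace [CompactSpace K] (hφ : IsLelekFunction φ) (hp : IsFanParam φ p v) :
    CompactSpace X := by
  have := hφ.compactSpace_region
  exact hp.surjective.compactSpace hp.continuous

lemma isQuotientMap [CompactSpace K] [T2Space X] (hφ : IsLelekFunction φ)
    (hp : IsFanParam φ p v) : IsQuotientMap p := by
  have := hφ.compactSpace_region
  exact hp.continuous.isClosedMap.isQuotientMap hp.continuous hp.surjective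

theorem exists_homeomorph {C D Y : Type*} [TopologicalSpace C] [TopologicalSpace D]
    [TopologicalSpace Y] [CompactSpace C] [CompactSpace D] [T2Space C] [T2Space D]
    [TotallyDisconnectedSpace C] [TotallyDisconnectedSpace D] [SecondCountableTopology C]
    [SecondCountableTopology D] [Nonempty C] [Nonempty D] [T2Space X] [T2Space Y]
    {φ : C → ℝ} {ψ : D → ℝ} (hφ : IsLelekFunction φ) (hψ : IsLelekFunction ψ)
    {p : SubgraphRegion φ → X} {v : X} (hp : IsFanParam φ p v)
    {q : SubgraphRegion ψ → Y} {w : Y} (hq : IsFanParam ψ q w) :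
    ∃ e : X ≃ₜ Y, e v = w := by
  obtain ⟨h, α, hα, hpos, hψφ⟩ := hφ.exists_homeomorph hψ
  -- Rescaling each leg by `α` maps one region onto the other and base onto base, so it descends to
  -- the collapsed spaces.
  let R : SubgraphRegion φ → SubgraphRegion ψ := fun x =>
    ⟨(h x.1.1, α x.1.1 * x.1.2), mul_nonneg (hpos _).le x.2.1, by
      simpa only [hψφ] using mul_le_mul_of_nonneg_left x.2.2 (hpos _).le⟩
  have hR : Continuous R := by
    refine Continuous.subtype_mk ?_ _
    fun_prop
  have hRinj : ∀ x y, R x = R y → x = y := by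
    intro x y e
    have e1 : h x.1.1 = h y.1.1 := congrArg (fun z => z.1.1) e
    have e2 : α x.1.1 * x.1.2 = α y.1.1 * y.1.2 := congrArg (fun z => z.1.2) e
    have e3 := h.injective e1
    rw [e3] at e2
    exact Subtype.ext (Prod.ext e3 (mul_left_cancel₀ (hpos _).ne' e2))
  have hR0 : ∀ x, (R x).1.2 = 0 ↔ x.1.2 = 0 := fun x => by simp [R, (hpos _).ne']
  have hRsurj : Function.Surjective R := by
    rintro ⟨⟨d, t⟩, ht0, ht⟩
    obtain ⟨c, rfl⟩ := h.surjective d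
    simp only [hψφ] at ht ht0
    refine ⟨⟨(c, t / α c), div_nonneg ht0 (hpos c).le, ?_⟩, ?_⟩
    · simpa only [div_le_iff₀ (hpos c), mul_comm] using ht
    · exact Subtype.ext (Prod.ext rfl (mul_div_cancel₀ _ (hpos c).ne'))
  let e : X → Y := fun x => q (R (Function.surjInv hp.surjective x))
  have he : ∀ x, e (p x) = q (R x) := by
    intro x
    have := Function.surjInv_eq hp.surjective (p x)
    rcases (hp.eq_iff _ _).1 this with h1 | ⟨h1, h2⟩
    · simp only [e, h1]
    · exact (hq.eq_iff _ _).2 (Or.inr ⟨(hR0 _).2 h1, (hR0 _).2 h2⟩)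
  have hec : Continuous e := by
    rw [(hp.isQuotientMap hφ).continuous_iff]
    exact (hq.continuous.comp hR).congr fun x => (he x).symm
  have hbij : Function.Bijective e := by
    constructor
    · intro a b hab
      obtain ⟨x, rfl⟩ := hp.surjective a
      obtain ⟨y, rfl⟩ := hp.surjective b
      rw [he, he, hq.eq_iff, hR0, hR0] at hab
      exact (hp.eq_iff _ _).2 (hab.imp_left (hRinj _ _))
    · intro y
      obtain ⟨z, rfl⟩ := hq.surjective y
      obtain ⟨x, rfl⟩ := hRsurj z
      exact ⟨p x, he x⟩
  have := hp.compactSpace hφ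
  have hec' : Continuous (Equiv.ofBijective e hbij) := hec
  refine ⟨hec'.homeoOfEquivCompactToT2, ?_⟩
  obtain ⟨x, hx⟩ := hp.surjective v
  change e v = w
  rw [← hx, he, hq.eq_top_iff, hR0, ← hp.eq_top_iff, hx]

/-- The arc from the top to the end of a leg. -/
lemma isArcBetween_leg [T2Space X] (hp : IsFanParam φ p v) {c : K} (hc : 0 < φ c) :
    ∃ hmem : ∀ s : unitInterval, 0 ≤ (s : ℝ) * φ c ∧ (s : ℝ) * φ c ≤ φ c,
      IsArcBetween (range fun s : unitInterval => p ⟨(c, s * φ c), hmem s⟩) v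
        (p ⟨(c, φ c), hc.le, le_rfl⟩) := by
  have hmem : ∀ s : unitInterval, 0 ≤ (s : ℝ) * φ c ∧ (s : ℝ) * φ c ≤ φ c := fun s =>
    ⟨mul_nonneg s.2.1 hc.le, mul_le_of_le_one_left hc.le s.2.2⟩
  refine ⟨hmem, _, (Continuous.isClosedEmbedding (hp.continuous.comp
    (Continuous.subtype_mk (by fun_prop) _)) ?_).isEmbedding, rfl, ?_, ?_⟩
  · intro s t e
    rcases (hp.eq_iff _ _).1 e with h | ⟨h1, h2⟩
    · have : (s : ℝ) * φ c = t * φ c := congrArg (fun z => z.1.2) h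
      exact Subtype.ext (mul_right_cancel₀ hc.ne' this)
    · simp only [mul_eq_zero, hc.ne', or_false] at h1 h2
      exact Subtype.ext (h1.trans h2.symm)
  · rw [Function.comp_apply, hp.eq_top_iff]; simp
  · simp

lemma not_mem_endPointSet [T2Space X] (hp : IsFanParam φ p v) (x : SubgraphRegion φ)
    (h0 : 0 < x.1.2) (h1 : x.1.2 < φ x.1.1) : p x ∉ endPointSet X := by
  intro hx
  have hφ := h0.trans h1
  obtain ⟨hmem, hA⟩ := hp.isArcBetween_leg hφ
  have hxA : p x ∈ range fun s : unitInterval => p ⟨(x.1.1, s * φ x.1.1), hmem s⟩ := by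
    refine ⟨⟨x.1.2 / φ x.1.1, div_nonneg h0.le hφ.le, (div_le_one hφ).2 h1.le⟩, ?_⟩
    exact congrArg p (Subtype.ext (Prod.ext rfl (div_mul_cancel₀ x.1.2 hφ.ne')))
  rcases hx _ _ _ hA hxA with h | h
  · exact h0.ne' ((hp.eq_top_iff x).1 h)
  · have := congrArg (fun z => z.1.2) (hp.eq_of_pos _ _ h h0)
    exact h1.ne this

lemma isLegCoordinates [CompactSpace K] [T2Space X] [TotallyDisconnectedSpace K]
    (hφ : IsLelekFunction φ) (hp : IsFanParam φ p v) :
    ∃ (κ : X → K) (τ : X → ℝ), IsLegCoordinates {x | 0 < τ x} univ κ τ ∧ Continuous τ ∧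
      (∀ x, τ (p x) = x.1.2) ∧ ∀ x, 0 < x.1.2 → κ (p x) = x.1.1 := by
  -- At the top `κ` is an arbitrary choice; only its values where `τ` is positive matter.
  let κ : X → K := fun x => (Function.surjInv hp.surjective x).1.1
  let τ : X → ℝ := fun x => (Function.surjInv hp.surjective x).1.2
  have hτ : ∀ x, τ (p x) = x.1.2 := by
    intro x
    rcases (hp.eq_iff _ _).1 (Function.surjInv_eq hp.surjective (p x)) with h | ⟨h1, h2⟩
    · simp only [τ, h]
    · exact h1.trans h2.symm
  have hκ : ∀ x, 0 < x.1.2 → κ (p x) = x.1.1 := by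
    intro x hx
    have := hp.eq_of_pos _ _ (Function.surjInv_eq hp.surjective (p x)).symm hx
    simp only [κ, ← this]
  have hτc : Continuous τ := by
    rw [(hp.isQuotientMap hφ).continuous_iff]
    exact (continuous_snd.comp continuous_subtype_val).congr fun x => (hτ x).symm
  have hopen : IsOpen {x | 0 < τ x} := isOpen_lt continuous_const hτc
  refine ⟨κ, τ, ⟨hopen, isTotallyDisconnected_of_totallyDisconnectedSpace _, mapsTo_univ _ _,
    ?_, hτc.continuousOn, ?_⟩, hτc, hτ, hκ⟩
  · rw [continuousOn_open_iff hopen]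
    intro W hW
    rw [← (hp.isQuotientMap hφ).isOpen_preimage]
    have : p ⁻¹' ({x | 0 < τ x} ∩ κ ⁻¹' W) = {x | 0 < x.1.2 ∧ x.1.1 ∈ W} := by
      ext x
      simp only [mem_preimage, mem_inter_iff, mem_ofPred_eq, hτ]
      exact and_congr_right fun h => by rw [hκ x h]
    rw [this]
    exact (isOpen_lt continuous_const (continuous_snd.comp continuous_subtype_val)).inter
      (hW.preimage (continuous_fst.comp continuous_subtype_val))
  · intro a ha b hb h1 h2
    obtain ⟨x, rfl⟩ := hp.surjective a
    obtain ⟨y, rfl⟩ := hp.surjective b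
    simp only [mem_ofPred_eq, hτ] at ha hb
    rw [hκ x ha, hκ y hb] at h1
    rw [hτ, hτ] at h2
    rw [show x = y from Subtype.ext (Prod.ext h1 h2)]

lemma mem_endPointSet [CompactSpace K] [T2Space X] [TotallyDisconnectedSpace K]
    (hφ : IsLelekFunction φ) (hp : IsFanParam φ p v) {c : K} (hc : 0 < φ c) :
    p ⟨(c, φ c), hc.le, le_rfl⟩ ∈ endPointSet X := by
  obtain ⟨κ, τ, hcoord, -, hτ, hκ⟩ := hp.isLegCoordinates hφ
  refine hcoord.mem_endPointSet (by simpa [hτ] using hc) fun y hy e => ?_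
  obtain ⟨x, rfl⟩ := hp.surjective y
  simp only [mem_ofPred_eq, hτ] at hy
  rw [hκ x hy, hκ _ hc] at e
  rw [hτ, hτ]
  simpa only [e] using x.2.2

lemma isFanTop [Nonempty K] [T2Space X] (hφ : IsLelekFunction φ) (hp : IsFanParam φ p v) :
    IsFanTop v := by
  obtain ⟨c₀, -, h₀⟩ := hφ.exists_pos univ isOpen_univ univ_nonempty
  obtain ⟨c₁, -, h₁, h₁'⟩ := hφ.exists_between univ isOpen_univ c₀ trivial 0 _ le_rfl h₀ le_rfl
  obtain ⟨c₂, -, h₂, h₂'⟩ := hφ.exists_between univ isOpen_univ c₁ trivial 0 _ le_rfl h₁ le_rfl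
  -- The three legs differ because their heights are strictly decreasing.
  let c : Fin 3 → K := ![c₀, c₁, c₂]
  have hpos : ∀ i, 0 < φ (c i) := by
    intro i; fin_cases i <;> assumption
  have hinj : ∀ i j, i ≠ j → c i ≠ c j := by
    have h01 : c₀ ≠ c₁ := fun h => by rw [h] at h₁'; exact lt_irrefl _ h₁'
    have h12 : c₁ ≠ c₂ := fun h => by rw [h] at h₂'; exact lt_irrefl _ h₂'
    have h02 : c₀ ≠ c₂ := fun h => by rw [h] at h₁'; exact lt_asymm h₁' h₂'
    intro i j hij
    fin_cases i <;> fin_cases j <;> simp_all [c, h01.symm, h12.symm, h02.symm]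
  choose hmem hA using fun i => hp.isArcBetween_leg (hpos i)
  refine ⟨_, _, hA, fun i j hij => ?_⟩
  ext x
  constructor
  · rintro ⟨⟨s, rfl⟩, ⟨t, e⟩⟩
    rcases (hp.eq_iff _ _).1 e with h | ⟨-, h⟩
    · exact absurd (congrArg (fun z => z.1.1) h) (hinj j i hij.symm)
    · exact (hp.eq_top_iff _).2 h
  · rintro rfl
    exact ⟨⟨0, (hp.eq_top_iff _).2 (by simp)⟩, ⟨0, (hp.eq_top_iff _).2 (by simp)⟩⟩

end IsFanParam

end FanParametrizations

/-! ### The region under a Lelek function on a Cantor set gives a Lelek fan. -/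

lemma mem_planarFan {C : Set ℝ} {z : ℝ × ℝ} :
    z ∈ planarFan C ↔ ∃ c ∈ C, ∃ t ∈ Icc (0 : ℝ) 1, z = (t * c, -t) := by
  simp only [planarFan, mem_iUnion, exists_prop, segment_eq_image, mem_image]
  refine exists_congr fun c => and_congr_right fun _ => exists_congr fun t =>
    and_congr_right fun _ => ?_
  simp [eq_comm]

section LelekFanOfParam

variable {K X : Type*} [TopologicalSpace K] [TopologicalSpace X] {φ : K → ℝ}
  {p : SubgraphRegion φ → X} {v : X}

namespace IsFanParam

lemma exists_leg_end_mem (hφ : IsLelekFunction φ) (hp : IsFanParam φ p v) {O : Set X}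
    (hO : IsOpen O) (hne : O.Nonempty) : ∃ c, ∃ hc : 0 < φ c, p ⟨(c, φ c), hc.le, le_rfl⟩ ∈ O := by
  obtain ⟨x, hx⟩ := hne
  obtain ⟨⟨⟨c, t⟩, ht0, ht⟩, rfl⟩ := hp.surjective x
  obtain ⟨O', hO', hpO⟩ := isOpen_induced_iff.1 (hO.preimage hp.continuous)
  have hmem : (c, t) ∈ O' := by
    have : (⟨(c, t), ht0, ht⟩ : SubgraphRegion φ) ∈ Subtype.val ⁻¹' O' := by rw [hpO]; exact hx
    exact this
  obtain ⟨V, W, hV, hW, hcV, htW, hVW⟩ := isOpen_prod_iff.1 hO' c t hmem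
  obtain ⟨ε, hε, hball⟩ := Metric.isOpen_iff.1 hW t htW
  rw [Real.ball_eq_Ioo] at hball
  suffices h : ∃ d ∈ V, 0 < φ d ∧ φ d ∈ Ioo (t - ε) (t + ε) by
    obtain ⟨d, hd, hd0, hdI⟩ := h
    refine ⟨d, hd0, ?_⟩
    have : (⟨(d, φ d), hd0.le, le_rfl⟩ : SubgraphRegion φ) ∈ Subtype.val ⁻¹' O' :=
      hVW ⟨hd, hball hdI⟩
    rw [hpO] at this
    exact this
  rcases ht0.eq_or_lt with rfl | ht0
  · obtain ⟨d, hd, hd0⟩ := hφ.exists_pos V hV ⟨c, hcV⟩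
    obtain ⟨d', hd', h1, h2⟩ := hφ.exists_between V hV d hd 0 (min ε (φ d)) le_rfl
      (lt_min hε hd0) (min_le_right _ _)
    exact ⟨d', hd', h1, by linarith, by linarith [min_le_left ε (φ d)]⟩
  · obtain ⟨d, hd, h1, h2⟩ := hφ.exists_between V hV c hcV (max 0 (t - ε)) t (le_max_left _ _)
      (max_lt ht0 (by linarith)) ht
    exact ⟨d, hd, (le_max_left _ _).trans_lt h1, (le_max_right _ _).trans_lt h1, by linarith⟩

lemma dense_endPointSet [CompactSpace K] [T2Space X] [TotallyDisconnectedSpace K]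
    (hφ : IsLelekFunction φ) (hp : IsFanParam φ p v) : Dense (endPointSet X) := by
  rw [dense_iff_inter_open]
  intro O hO hne
  obtain ⟨c, hc, h⟩ := hp.exists_leg_end_mem hφ hO hne
  exact ⟨_, h, hp.mem_endPointSet hφ hc⟩

lemma connectedSpace (hp : IsFanParam φ p v) : ConnectedSpace X := by
  rw [connectedSpace_iff_univ]
  refine ⟨⟨v, trivial⟩, isPreconnected_of_forall v fun y _ => ?_⟩
  obtain ⟨⟨⟨c, t⟩, ht0, ht⟩, rfl⟩ := hp.surjective y
  have hmem : ∀ s : unitInterval, 0 ≤ (s : ℝ) * t ∧ (s : ℝ) * t ≤ φ c := fun s =>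
    ⟨mul_nonneg s.2.1 ht0, (mul_le_of_le_one_left ht0 s.2.2).trans ht⟩
  refine ⟨range fun s : unitInterval => p ⟨(c, s * t), hmem s⟩, subset_univ _,
    ⟨0, (hp.eq_top_iff _).2 (by simp)⟩, ⟨1, by simp⟩, isPreconnected_range ?_⟩
  exact hp.continuous.comp (Continuous.subtype_mk (by fun_prop) _)

lemma exists_embedding [CompactSpace K] [T2Space X] (hφ : IsLelekFunction φ)
    (hp : IsFanParam φ p v) (k : K ≃ₜ cantorSet) :
    ∃ e : X → ℝ × ℝ, IsEmbedding e ∧ range e ⊆ planarFan cantorSet := by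
  have := hp.compactSpace hφ
  let q : SubgraphRegion φ → ℝ × ℝ := fun x => (x.1.2 * k x.1.1, -x.1.2)
  have hq : Continuous q := by fun_prop
  have hq_iff : ∀ x y, q x = q y ↔ p x = p y := by
    intro x y
    rw [hp.eq_iff]
    simp only [q, Prod.ext_iff, neg_inj]
    constructor
    · rintro ⟨h1, h2⟩
      by_cases h0 : x.1.2 = 0
      · exact Or.inr ⟨h0, h2 ▸ h0⟩
      · rw [← h2] at h1
        exact Or.inl (Subtype.ext (Prod.ext
          (k.injective (Subtype.ext (mul_left_cancel₀ h0 h1))) h2))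
    · rintro (rfl | ⟨h1, h2⟩)
      · exact ⟨rfl, rfl⟩
      · simp [h1, h2]
  let e : X → ℝ × ℝ := fun x => q (Function.surjInv hp.surjective x)
  have he : ∀ x, e (p x) = q x := fun x => (hq_iff _ _).2 (Function.surjInv_eq hp.surjective _)
  have hec : Continuous e := by
    rw [(hp.isQuotientMap hφ).continuous_iff]
    exact hq.congr fun x => (he x).symm
  refine ⟨e, (hec.isClosedEmbedding ?_).isEmbedding, ?_⟩
  · intro a b hab
    have := (hq_iff _ _).1 hab
    rwa [Function.surjInv_eq hp.surjective, Function.surjInv_eq hp.surjective] at this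
  · rintro _ ⟨a, rfl⟩
    obtain ⟨x, rfl⟩ := hp.surjective a
    rw [he]
    exact mem_planarFan.2 ⟨_, (k x.1.1).2, x.1.2, ⟨x.2.1, x.2.2.trans (hφ.le_one _)⟩, rfl⟩

theorem isLelekFan [T2Space X] (hφ : IsLelekFunction φ) (hp : IsFanParam φ p v)
    (k : K ≃ₜ cantorSet) : IsLelekFan X := by
  let k' : K ≃ₜ (ℕ → Bool) := k.trans cantorSetHomeomorphNatToBool
  have : CompactSpace K := k'.symm.compactSpace
  have : TotallyDisconnectedSpace K := k'.symm.totallyDisconnectedSpace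
  have : Nonempty K := ⟨k'.symm fun _ => true⟩
  obtain ⟨c, -, hc⟩ := hφ.exists_pos univ isOpen_univ univ_nonempty
  refine ⟨hp.compactSpace hφ, hp.connectedSpace, ⟨v, p ⟨(c, φ c), hc.le, le_rfl⟩, fun h => ?_⟩,
    ⟨cantorSet, ⟨cantorSet_subset_unitInterval, ⟨Homeomorph.refl _⟩⟩, hp.exists_embedding hφ k⟩,
    hp.dense_endPointSet hφ⟩
  exact hc.ne' ((hp.eq_top_iff _).1 h.symm)

end IsFanParam

end LelekFanOfParam

/-! ### Every Lelek fan comes from a Lelek function. -/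

section ParamOfLelekFan

variable {L : Type*} [TopologicalSpace L] {C : Set ℝ} {e : L → ℝ × ℝ}

/-- The slope coordinate of a point in the planar fan. -/
noncomputable def legSlope (z : ℝ × ℝ) : ℝ := z.1 / -z.2

lemma exists_eq_of_mem_planarFan {z : ℝ × ℝ} (hz : z ∈ planarFan C) :
    0 ≤ -z.2 ∧ -z.2 ≤ 1 ∧ (-z.2 = 0 → z = (0, 0)) ∧
      (0 < -z.2 → legSlope z ∈ C ∧ z = (-z.2 * legSlope z, -(-z.2))) := by
  obtain ⟨c, hc, t, ht, rfl⟩ := mem_planarFan.1 hz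
  refine ⟨by simpa using ht.1, by simpa using ht.2, fun h => ?_, fun h => ?_⟩
  · simp only [neg_neg] at h
    simp [h]
  · simp only [neg_neg] at h
    have : legSlope (t * c, -t) = c := by simp [legSlope, h.ne']
    rw [this]
    exact ⟨hc, by simp⟩

lemma isLegCoordinates_of_planarFan (he : IsEmbedding e) (hsub : range e ⊆ planarFan C)
    (hC : IsTotallyDisconnected C) :
    IsLegCoordinates {x | 0 < -(e x).2} C (fun x => legSlope (e x)) (fun x => -(e x).2) := by
  have hc := he.continuous
  have hfan : ∀ x, e x ∈ planarFan C := fun x => hsub (mem_range_self x)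
  refine ⟨isOpen_lt continuous_const (by fun_prop), hC,
    fun x hx => ((exists_eq_of_mem_planarFan (hfan x)).2.2.2 hx).1, ?_, by fun_prop, ?_⟩
  · exact ContinuousOn.div (by fun_prop) (by fun_prop) fun x hx =>
      (show 0 < -(e x).2 from hx).ne'
  · intro x hx y hy h1 h2
    apply he.injective
    rw [((exists_eq_of_mem_planarFan (hfan x)).2.2.2 hx).2,
      ((exists_eq_of_mem_planarFan (hfan y)).2.2.2 hy).2, h1, h2]

/-- Leg coordinates exist everywhere away from the apex of the planar fan, and they exclude
ramification. -/
lemma map_isFanTop_eq_zero (he : IsEmbedding e) (hsub : range e ⊆ planarFan C)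
    (hC : IsTotallyDisconnected C) {v : L} (hv : IsFanTop v) : e v = (0, 0) := by
  have h := exists_eq_of_mem_planarFan (hsub (mem_range_self v))
  rcases h.1.eq_or_lt with h0 | h0
  · exact h.2.2.1 h0.symm
  · exact absurd hv ((isLegCoordinates_of_planarFan he hsub hC).not_isFanTop h0)

lemma isTotallyDisconnected_of_isCantorSetInUnit (hC : IsCantorSetInUnit C) :
    IsTotallyDisconnected C ∧ IsCompact C := by
  obtain ⟨-, ⟨k⟩⟩ := hC
  let k' : C ≃ₜ (ℕ → Bool) := k.trans cantorSetHomeomorphNatToBool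
  have h1 : CompactSpace C := k'.symm.compactSpace
  have h2 : TotallyDisconnectedSpace C := k'.symm.totallyDisconnectedSpace
  exact ⟨totallyDisconnectedSpace_subtype_iff.1 h2, isCompact_iff_compactSpace.2 h1⟩

/-- The part of a leg below a point of a connected subfan belongs to the subfan. -/
lemma leg_subset_range [CompactSpace L] [ConnectedSpace L] (he : IsEmbedding e)
    (hsub : range e ⊆ planarFan C) (hC : IsTotallyDisconnected C) (hCc : IsCompact C)
    {v : L} (hv : e v = (0, 0)) {c t s : ℝ} (ht : (t * c, -t) ∈ range e) (h0s : 0 ≤ s)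
    (hst : s ≤ t) : (s * c, -s) ∈ range e := by
  rcases h0s.eq_or_lt with rfl | hs
  · exact ⟨v, by simp [hv]⟩
  by_contra hnot
  obtain ⟨x, hx⟩ := ht
  have hcoord := isLegCoordinates_of_planarFan he hsub hC
  have hlt : s < t := lt_of_le_of_ne hst fun h => hnot ⟨x, by rw [hx, h]⟩
  have hxs : legSlope (e x) = c := by simp [legSlope, hx, (hs.trans hlt).ne']
  have hrange : IsClosed (range e) := (isCompact_range he.continuous).isClosed
  have hcC : c ∈ C := hxs ▸ hcoord.mapsTo (by simpa [hx] using hs.trans hlt)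
  have : CompactSpace C := isCompact_iff_compactSpace.1 hCc
  have : TotallyDisconnectedSpace C := totallyDisconnectedSpace_subtype_iff.2 hC
  have hN : IsOpen {d : C | (s * (d : ℝ), -s) ∈ (range e)ᶜ} :=
    hrange.isOpen_compl.preimage (by fun_prop)
  obtain ⟨W, hW, hcW, hWsub⟩ := compact_exists_isClopen_in_isOpen hN
    (show (⟨c, hcC⟩ : C) ∈ _ from hnot)
  obtain ⟨O, hO, rfl⟩ := isOpen_induced_iff.1 hW.2
  obtain ⟨F, hF, hOF⟩ := isClosed_induced_iff.1 hW.1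
  have hOF' : ∀ d ∈ C, d ∈ F ↔ d ∈ O := fun d hd =>
    (Set.ext_iff.1 hOF ⟨d, hd⟩)
  have hce := he.continuous
  have hfan : ∀ x, e x ∈ planarFan C := fun x => hsub (mem_range_self x)
  -- All slopes in `O ∩ C` miss height `s`, so `s <` and `s ≤` cut out the same set over them. `Q`
  -- is therefore clopen; it contains `x` but not `v`, against connectedness.
  set Q : Set L := {x | s < -(e x).2} ∩ (fun x => legSlope (e x)) ⁻¹' O with hQ
  have hQo : IsOpen Q := by
    refine (hcoord.continuousOn_fst.mono fun y hy => ?_).isOpen_inter_preimage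
      (isOpen_lt continuous_const (by fun_prop)) hO
    exact hs.trans hy
  have hQ' : Q = {x | s ≤ -(e x).2} ∩ (fun x => legSlope (e x)) ⁻¹' F := by
    ext y
    constructor
    · rintro ⟨h1, h2⟩
      exact ⟨(show s < -(e y).2 from h1).le, (hOF' _ (hcoord.mapsTo (hs.trans h1))).2 h2⟩
    · rintro ⟨h1, h2⟩
      have hyC : legSlope (e y) ∈ C := hcoord.mapsTo (hs.trans_le h1)
      have h3 := (hOF' _ hyC).1 h2
      refine ⟨(show s ≤ -(e y).2 from h1).lt_of_ne fun h => ?_, h3⟩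
      refine hWsub (show (⟨_, hyC⟩ : C) ∈ _ from h3) ⟨y, ?_⟩
      have := ((exists_eq_of_mem_planarFan (hfan y)).2.2.2 (hs.trans_le h1)).2
      rwa [← h] at this
  have hQc : IsClosed Q := by
    rw [hQ']
    refine (hcoord.continuousOn_fst.mono fun y hy => ?_).preimage_isClosed_of_isClosed
      (isClosed_le continuous_const (by fun_prop)) hF
    exact hs.trans_le hy
  rcases isClopen_iff.1 ⟨hQc, hQo⟩ with h | h
  · have : x ∈ Q := ⟨by simpa [hx] using hlt, by simpa [hxs] using hcW⟩
    rw [h] at this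
    exact this
  · have : v ∈ Q := h ▸ trivial
    have := this.1
    simp [hv] at this
    linarith

/-- The height at slope `c` of the subfan with the embedding `e`. -/
noncomputable def fanHeight (e : L → ℝ × ℝ) (c : ℝ) : ℝ :=
  sSup {t : ℝ | t ∈ Icc (0 : ℝ) 1 ∧ (t * c, -t) ∈ range e}

lemma fanHeight_mem [CompactSpace L] (he : IsEmbedding e) {v : L} (hv : e v = (0, 0)) (c : ℝ) :
    fanHeight e c ∈ Icc (0 : ℝ) 1 ∧ (fanHeight e c * c, -fanHeight e c) ∈ range e := by
  have hrange : IsClosed (range e) := (isCompact_range he.continuous).isClosed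
  have hcomp : IsCompact {t : ℝ | t ∈ Icc (0 : ℝ) 1 ∧ (t * c, -t) ∈ range e} :=
    isCompact_Icc.inter_right (hrange.preimage (f := fun t : ℝ => (t * c, -t)) (by fun_prop))
  exact hcomp.sSup_mem ⟨0, ⟨le_rfl, zero_le_one⟩, v, by simp [hv]⟩

lemma le_fanHeight {L : Type*} {e : L → ℝ × ℝ} (hsub : range e ⊆ planarFan C) {c t : ℝ} (h : (t * c, -t) ∈ range e) :
    t ≤ fanHeight e c := by
  have := exists_eq_of_mem_planarFan (hsub h)
  simp only [neg_neg] at this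
  exact le_csSup ⟨1, fun s hs => hs.1.2⟩ ⟨⟨this.1, this.2.1⟩, h⟩

/-- The base is the closure of the slopes with positive height, since a Lelek function must be
positive on a dense set. Connectedness fills the legs, compactness gives upper semicontinuity, and
density of end-points gives the intermediate heights. -/
theorem IsLelekFan.exists_isFanParam [T2Space L] (hL : IsLelekFan L) {v : L} (hv : IsFanTop v) :
    ∃ (K : Set ℝ) (φ : K → ℝ) (p : SubgraphRegion φ → L), IsCompact K ∧ IsTotallyDisconnected K ∧
      K.Nonempty ∧ IsLelekFunction φ ∧ IsFanParam φ p v := by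
  obtain ⟨hLc, hLconn, hLnt, ⟨C, hC, e, he, hsub⟩, hdense⟩ := hL
  obtain ⟨hCt, hCc⟩ := isTotallyDisconnected_of_isCantorSetInUnit hC
  have hv0 := map_isFanTop_eq_zero he hsub hCt hv
  have hcoord := isLegCoordinates_of_planarFan he hsub hCt
  have hfan : ∀ x, e x ∈ planarFan C := fun x => hsub (mem_range_self x)
  have hce := he.continuous
  have hrange : IsClosed (range e) := (isCompact_range he.continuous).isClosed
  have hleg : ∀ {c t s : ℝ}, (t * c, -t) ∈ range e → 0 ≤ s → s ≤ t → (s * c, -s) ∈ range e :=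
    fun ht h1 h2 => leg_subset_range he hsub hCt hCc hv0 ht h1 h2
  have hh := fanHeight_mem he hv0
  have husc : UpperSemicontinuous (fanHeight e) := by
    rw [upperSemicontinuous_iff_isClosed_preimage]
    intro y
    rcases le_or_gt y 0 with hy | hy
    · convert isClosed_univ using 1
      exact eq_univ_of_forall fun c => hy.trans (hh c).1.1
    · convert hrange.preimage (f := fun c : ℝ => (y * c, -y)) (by fun_prop) using 1
      ext c
      exact ⟨fun h => hleg (hh c).2 hy.le h, fun h => le_fanHeight hsub h⟩
  have hpt : ∀ x, 0 < -(e x).2 → e x = (-(e x).2 * legSlope (e x), -(-(e x).2)) := fun x hx =>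
    ((exists_eq_of_mem_planarFan (hfan x)).2.2.2 hx).2
  have hle : ∀ x, 0 < -(e x).2 → -(e x).2 ≤ fanHeight e (legSlope (e x)) := fun x hx =>
    le_fanHeight hsub ⟨x, hpt x hx⟩
  set P : Set ℝ := {c | 0 < fanHeight e c} with hP
  have hPC : P ⊆ C := by
    intro c hc
    obtain ⟨x, hx⟩ := (hh c).2
    have h1 : legSlope (e x) = c := by simp [legSlope, hx, (show 0 < fanHeight e c from hc).ne']
    exact h1 ▸ hcoord.mapsTo (show 0 < -(e x).2 by simpa [hx] using show 0 < fanHeight e c from hc)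
  have hKC : closure P ⊆ C := closure_minimal hPC hCc.isClosed
  have hmemP : ∀ x, 0 < -(e x).2 → legSlope (e x) ∈ P := fun x hx => hx.trans_le (hle x hx)
  have hex : ∀ x : SubgraphRegion fun c : closure P => fanHeight e c,
      ∃ y, e y = (x.1.2 * x.1.1, -x.1.2) := fun x => hleg (hh _).2 x.2.1 x.2.2
  choose p hp using hex
  have hPne : P.Nonempty := by
    obtain ⟨y, hy⟩ := exists_ne v
    have hy' := exists_eq_of_mem_planarFan (hfan y)
    rcases hy'.1.eq_or_lt with h | h
    · exact absurd (he.injective ((hy'.2.2.1 h.symm).trans hv0.symm)) hy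
    · exact ⟨_, hmemP y h⟩
  have hparam : IsFanParam (fun c : closure P => fanHeight e c) p v := by
    refine ⟨?_, ?_, ?_, ?_⟩
    · rw [he.continuous_iff]
      have : (e ∘ p) = fun x => (x.1.2 * (x.1.1 : ℝ), -x.1.2) := funext hp
      rw [this]
      fun_prop
    · intro y
      have hy' := exists_eq_of_mem_planarFan (hfan y)
      rcases hy'.1.eq_or_lt with h | h
      · obtain ⟨c, hc⟩ := hPne
        refine ⟨⟨(⟨c, subset_closure hc⟩, 0), le_rfl, (hh c).1.1⟩, he.injective ?_⟩
        rw [hp, hy'.2.2.1 h.symm]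
        simp
      · refine ⟨⟨(⟨_, subset_closure (hmemP y h)⟩, -(e y).2), h.le, hle y h⟩, he.injective ?_⟩
        rw [hp]
        exact (hpt y h).symm
    · intro x
      rw [← he.injective.eq_iff, hp, hv0]
      simp +contextual
    · intro x y hxy h0
      have := congrArg e hxy
      rw [hp, hp, Prod.ext_iff] at this
      simp only [neg_inj] at this
      obtain ⟨h1, h2⟩ := this
      rw [← h2] at h1
      exact Subtype.ext (Prod.ext (Subtype.ext (mul_left_cancel₀ h0.ne' h1)) h2)
  refine ⟨closure P, fun c => fanHeight e c, p, hCc.of_isClosed_subset isClosed_closure hKC,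
    fun t ht => hCt t (ht.trans hKC), hPne.closure, ⟨husc.comp continuous_subtype_val,
    fun x => (hh x).1.1, fun x => (hh x).1.2, ?_, ?_⟩, hparam⟩
  · rintro V hV ⟨⟨c, hc⟩, hcV⟩
    obtain ⟨O, hO, rfl⟩ := isOpen_induced_iff.1 hV
    obtain ⟨d, hdO, hdP⟩ := mem_closure_iff.1 hc O hO hcV
    exact ⟨⟨d, subset_closure hdP⟩, hdO, hdP⟩
  · rintro V hV y hyV a b ha hab hb
    obtain ⟨O, hO, rfl⟩ := isOpen_induced_iff.1 hV
    -- This open set contains the point of height `(a + b) / 2` on the leg `y`, hence also an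
    -- end-point. An end-point of positive height is the tip of its leg, so its height is a value of
    -- `fanHeight`.
    have hopen : IsOpen ({x : L | 0 < -(e x).2 ∧ a < -(e x).2 ∧ -(e x).2 < b} ∩
        (fun x => legSlope (e x)) ⁻¹' O) := by
      refine (hcoord.continuousOn_fst.mono fun y hy => hy.1).isOpen_inter_preimage ?_ hO
      have hτ : Continuous fun x => -(e x).2 := by fun_prop
      exact (isOpen_lt continuous_const hτ).inter
        ((isOpen_lt continuous_const hτ).inter (isOpen_lt hτ continuous_const))
    have hm0 : 0 < (a + b) / 2 := by linarith
    have hz := hp ⟨(y, (a + b) / 2), hm0.le, by linarith⟩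
    set z := p ⟨(y, (a + b) / 2), hm0.le, by linarith⟩
    simp only at hz
    have hzs : legSlope (e z) = y := by
      simp only [legSlope, hz, neg_neg]
      exact mul_div_cancel_left₀ _ hm0.ne'
    obtain ⟨x, ⟨⟨hx0, hxa, hxb⟩, hxO⟩, hxE⟩ := dense_iff_inter_open.1 hdense _ hopen
      ⟨z, by rw [mem_ofPred_eq, hz, neg_neg]; exact ⟨hm0, by linarith, by linarith⟩,
        by rw [mem_preimage, hzs]; exact hyV⟩
    obtain ⟨w, rfl⟩ := hparam.surjective x
    have hw2 : -(e (p w)).2 = w.1.2 := by rw [hp]; simp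
    rw [hw2] at hx0 hxa hxb
    have hw1 : legSlope (e (p w)) = w.1.1 := by
      rw [hp]; simp only [legSlope, neg_neg]; field_simp
    have heq : w.1.2 = fanHeight e w.1.1 := by
      refine le_antisymm w.2.2 (not_lt.1 fun h => ?_)
      exact hparam.not_mem_endPointSet w hx0 h hxE
    rw [mem_preimage, hw1] at hxO
    exact ⟨w.1.1, hxO, heq ▸ hxa, heq ▸ hxb⟩

end ParamOfLelekFan

/-! ### Arithmetic of never connecting pairs. -/

section NeverConnecting

variable {r ρ : ℝ}

lemma neverConnect_half_three : NeverConnect (1 / 2) 3 := by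
  refine ⟨by norm_num, by norm_num, by norm_num, fun k l => ⟨fun h => ?_, ?_⟩⟩
  · have hq : ((1 / 2 : ℚ)) ^ k = 3 ^ l := by exact_mod_cast (by push_cast; exact h :
      (((1 / 2 : ℚ) ^ k : ℚ) : ℝ) = ((3 ^ l : ℚ) : ℝ))
    have h2 := congrArg (padicValRat 2) hq
    have h3 := congrArg (padicValRat 3) hq
    have : Fact (Nat.Prime 2) := ⟨Nat.prime_two⟩
    have : Fact (Nat.Prime 3) := ⟨Nat.prime_three⟩
    have e23 : padicValRat 2 3 = 0 := by
      have : ((3 : ℕ) : ℚ) = 3 := by norm_num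
      rw [← this, padicValRat.of_nat]
      norm_num [padicValNat.eq_zero_of_not_dvd]
    have e32 : padicValRat 3 2 = 0 := by
      have : ((2 : ℕ) : ℚ) = 2 := by norm_num
      rw [← this, padicValRat.of_nat]
      norm_num [padicValNat.eq_zero_of_not_dvd]
    have e22 : padicValRat 2 2 = 1 := by
      exact_mod_cast padicValRat.self (p := 2) (by norm_num)
    have e33 : padicValRat 3 3 = 1 := by
      exact_mod_cast padicValRat.self (p := 3) (by norm_num)
    rw [padicValRat.zpow, padicValRat.zpow, one_div, padicValRat.inv] at h2 h3
    rw [e23, e22] at h2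
    rw [e32, e33] at h3
    constructor <;> linarith
  · rintro ⟨rfl, rfl⟩
    simp

lemma NeverConnect.irrational_log_div (h : NeverConnect r ρ) :
    Irrational (Real.log r / Real.log ρ) := by
  obtain ⟨hr0, hr1, hρ, hkl⟩ := h
  have hlρ : 0 < Real.log ρ := Real.log_pos hρ
  rintro ⟨x, hx⟩
  have hd : (x.den : ℝ) ≠ 0 := by exact_mod_cast x.den_ne_zero
  have h1 : (x.den : ℝ) * Real.log r = x.num * Real.log ρ := by
    rw [Rat.cast_def] at hx
    field_simp at hx
    linarith
  have h2 : r ^ (x.den : ℤ) = ρ ^ x.num := by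
    apply Real.log_injOn_pos (mem_Ioi.2 (by positivity)) (mem_Ioi.2 (by positivity))
    rw [Real.log_zpow, Real.log_zpow]
    exact_mod_cast h1
  have := ((hkl _ _).1 h2).1
  exact x.den_ne_zero (by exact_mod_cast this)

/-- In logarithms this is density of the forward orbit of an irrational rotation by `log r` on the
circle of length `log ρ`. -/
lemma NeverConnect.exists_pow_mul_pow (h : NeverConnect r ρ) {p q : ℝ} (hp : 0 < p) (hq0 : 0 < q)
    (hq : q < 1) : ∃ i j : ℕ, q < p * r ^ i * ρ ^ j ∧ p * r ^ i * ρ ^ j < 1 := by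
  have hirr := h.irrational_log_div
  obtain ⟨hr0, hr1, hρ, -⟩ := h
  have hlρ : 0 < Real.log ρ := Real.log_pos hρ
  have hlr : Real.log r < 0 := Real.log_neg hr0 hr1
  -- Starting below `q` puts the target interval for `x` on the positive side, which forces the
  -- exponent `j` of `ρ` to be positive.
  obtain ⟨m, hm⟩ := exists_pow_lt_of_lt_one (div_pos hq0 hp) hr1
  rw [lt_div_iff₀ hp, mul_comm] at hm
  set s := p * r ^ m with hs
  have hs0 : 0 < s := by positivity
  have hls : Real.log s < Real.log q := Real.log_lt_log hs0 hm
  have hdense : DenseRange fun n : ℕ => n • (Real.log r : AddCircle (Real.log ρ)) := by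
    have : Fact (0 < Real.log ρ) := ⟨hlρ⟩
    exact denseRange_zsmul_iff_nsmul.1 (AddCircle.denseRange_zsmul_coe_iff.2 hirr)
  have hopen : IsOpen ((QuotientAddGroup.mk : ℝ → AddCircle (Real.log ρ)) ''
      Ioo (Real.log q - Real.log s) (-Real.log s)) :=
    QuotientAddGroup.isOpenMap_coe _ isOpen_Ioo
  have hne : (Ioo (Real.log q - Real.log s) (-Real.log s)).Nonempty :=
    nonempty_Ioo.2 (by linarith [Real.log_neg hq0 hq])
  obtain ⟨i, x, ⟨hx1, hx2⟩, hxi⟩ := hdense.exists_mem_open hopen (hne.image _)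
  have hxi' : (x : AddCircle (Real.log ρ)) = ((i • Real.log r : ℝ) : AddCircle (Real.log ρ)) := hxi
  rw [← sub_eq_zero, ← AddCircle.coe_sub, AddCircle.coe_eq_zero_iff] at hxi'
  obtain ⟨j, hj⟩ := hxi'
  rw [zsmul_eq_mul, nsmul_eq_mul] at hj
  have hj0 : 0 < j := by
    have h1 : (i : ℝ) * Real.log r ≤ 0 := mul_nonpos_of_nonneg_of_nonpos i.cast_nonneg hlr.le
    have h2 : 0 < (j : ℝ) * Real.log ρ := by linarith
    exact_mod_cast (pos_iff_pos_of_mul_pos h2).2 hlρ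
  lift j to ℕ using hj0.le
  have hpos : 0 < p * r ^ (m + i) * ρ ^ j := by positivity
  have hlog : Real.log (p * r ^ (m + i) * ρ ^ j) = Real.log s + x := by
    rw [pow_add, ← mul_assoc, ← hs, Real.log_mul (by positivity) (by positivity),
      Real.log_mul hs0.ne' (by positivity), Real.log_pow, Real.log_pow]
    push_cast at hj
    linarith
  refine ⟨m + i, j, (Real.log_lt_log_iff hq0 hpos).1 (by rw [hlog]; linarith), ?_⟩
  refine (Real.log_neg_iff hpos).1 ?_
  rw [hlog]
  linarith

end NeverConnecting

/-! ### Bi-infinite sequences with prescribed steps. -/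

section PathProducts

variable {r ρ : ℝ}

/-- The factor by which a step changes a coordinate. -/
def stepFactor (r ρ : ℝ) (b : Bool) : ℝ := if b then ρ else r

/-- The sequence with value `1` at `0` whose steps are prescribed by `ω`. -/
noncomputable def pathProd (r ρ : ℝ) (ω : ℤ → Bool) (k : ℤ) : ℝ :=
  (∏ j ∈ Finset.Ico 0 k, stepFactor r ρ (ω j)) / ∏ j ∈ Finset.Ico k 0, stepFactor r ρ (ω j)

/-- The bi-infinite sequence `z` has the steps prescribed by `ω`. -/
def HasSteps (r ρ : ℝ) (ω : ℤ → Bool) (z : ℤ → ℝ) : Prop :=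
  ∀ k, z (k + 1) = z k * stepFactor r ρ (ω k)

lemma stepFactor_pos (hr : 0 < r) (hρ : 0 < ρ) (b : Bool) : 0 < stepFactor r ρ b := by
  unfold stepFactor; split_ifs <;> assumption

lemma pathProd_pos (hr : 0 < r) (hρ : 0 < ρ) (ω : ℤ → Bool) (k : ℤ) : 0 < pathProd r ρ ω k :=
  div_pos (Finset.prod_pos fun _ _ => stepFactor_pos hr hρ _)
    (Finset.prod_pos fun _ _ => stepFactor_pos hr hρ _)

@[simp]
lemma pathProd_zero (ω : ℤ → Bool) : pathProd r ρ ω 0 = 1 := by simp [pathProd]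

lemma hasSteps_pathProd (hr : 0 < r) (hρ : 0 < ρ) (ω : ℤ → Bool) :
    HasSteps r ρ ω (pathProd r ρ ω) := by
  intro k
  have h0 := (stepFactor_pos hr hρ (ω k)).ne'
  unfold pathProd
  rcases lt_or_ge k 0 with hk | hk
  · rw [Finset.Ico_eq_empty_of_le hk.le, Finset.Ico_eq_empty_of_le (show k + 1 ≤ 0 by omega),
      ← Finset.insert_Ico_add_one_left_eq_Ico hk, Finset.prod_insert (by simp)]
    field_simp
  · rw [Finset.Ico_eq_empty_of_le hk, Finset.Ico_eq_empty_of_le (show 0 ≤ k + 1 by omega),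
      ← Finset.insert_Ico_right_eq_Ico_add_one hk, Finset.prod_insert (by simp)]
    simp [mul_comm]

lemma continuous_pathProd (hr : 0 < r) (hρ : 0 < ρ) (k : ℤ) :
    Continuous fun ω => pathProd r ρ ω k := by
  have h : ∀ j : ℤ, Continuous fun ω : ℤ → Bool => stepFactor r ρ (ω j) := fun j =>
    
    (continuous_of_discreteTopology (f := stepFactor r ρ)).comp (continuous_apply j)
  exact (continuous_finsetProd _ fun j _ => h j).div (continuous_finsetProd _ fun j _ => h j)
    fun ω => (Finset.prod_pos fun _ _ => stepFactor_pos hr hρ _).ne'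

namespace HasSteps

variable {ω ω' : ℤ → Bool} {z w : ℤ → ℝ}

lemma const_mul (h : HasSteps r ρ ω z) (t : ℝ) : HasSteps r ρ ω fun k => t * z k := fun k => by
  simp only [h k, mul_assoc]

lemma shift (h : HasSteps r ρ ω z) (m : ℤ) : HasSteps r ρ (fun k => ω (k + m)) fun k => z (k + m) :=
  fun k => by rw [← h (k + m)]; ring_nf

/-- Two sequences with the same steps in a window are proportional there. -/
lemma mul_eq_mul (h : HasSteps r ρ ω z) (h' : HasSteps r ρ ω' w) {A B k : ℤ}
    (heq : ∀ k, A ≤ k → k < B → ω k = ω' k) (hA : A ≤ k) (hB : k ≤ B) : z k * w A = w k * z A := by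
  induction k, hA using Int.leInduction with
  | base => ring
  | succ k hk ih =>
    have := ih (by omega)
    rw [h k, h' k, heq k hk (by omega)]
    linear_combination stepFactor r ρ (ω' k) * this

lemma eq_mul_pathProd (hr : 0 < r) (hρ : 0 < ρ) (h : HasSteps r ρ ω z) (k : ℤ) :
    z k = z 0 * pathProd r ρ ω k := by
  have hP := hasSteps_pathProd hr hρ ω
  rcases le_total 0 k with hk | hk
  · have := h.mul_eq_mul hP (A := 0) (B := k) (fun _ _ _ => rfl) hk le_rfl
    rw [pathProd_zero] at this
    linarith
  · have := h.mul_eq_mul hP (A := k) (B := 0) (fun _ _ _ => rfl) hk le_rfl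
    rw [pathProd_zero] at this
    linarith

lemma eq_on_window (hr : 0 < r) (hρ : 0 < ρ) (h : HasSteps r ρ ω z) (h' : HasSteps r ρ ω' w)
    (h0 : z 0 = w 0) {A B k : ℤ} (hA0 : A ≤ 0) (h0B : 0 ≤ B)
    (heq : ∀ k, A ≤ k → k < B → ω k = ω' k) (hA : A ≤ k) (hB : k ≤ B) : z k = w k := by
  rcases le_total 0 k with hk | hk
  · have e := h.mul_eq_mul h' (A := 0) (B := B) (fun k h1 h2 => heq k (hA0.trans h1) h2) hk hB
    rcases eq_or_ne (z 0) 0 with hz | hz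
    · rw [h.eq_mul_pathProd hr hρ, h'.eq_mul_pathProd hr hρ, ← h0, hz, zero_mul, zero_mul]
    · rw [← h0] at e
      exact mul_right_cancel₀ hz e
  · have e := h.mul_eq_mul h' (A := k) (B := B) (fun j h1 h2 => heq j (hA.trans h1) h2) hk h0B
    rcases eq_or_ne (z 0) 0 with hz | hz
    · rw [h.eq_mul_pathProd hr hρ, h'.eq_mul_pathProd hr hρ, ← h0, hz, zero_mul, zero_mul]
    · rw [← h0] at e
      exact (mul_left_cancel₀ hz e).symm

lemma run_false (h : HasSteps r ρ ω z) {A : ℤ} {n : ℕ}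
    (hω : ∀ k, A ≤ k → k < A + n → ω k = false) : z (A + n) = z A * r ^ n := by
  induction n with
  | zero => simp
  | succ n ih =>
    push_cast
    rw [← add_assoc, h (A + n), ih fun k h1 h2 => hω k h1 (by push_cast; omega),
      hω _ (by omega) (by push_cast; omega), pow_succ]
    simp [stepFactor, mul_assoc]

lemma run_true (h : HasSteps r ρ ω z) {A : ℤ} {n : ℕ}
    (hω : ∀ k, A ≤ k → k < A + n → ω k = true) : z (A + n) = z A * ρ ^ n := by
  induction n with
  | zero => simp
  | succ n ih =>
    push_cast
    rw [← add_assoc, h (A + n), ih fun k h1 h2 => hω k h1 (by push_cast; omega),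
      hω _ (by omega) (by push_cast; omega), pow_succ]
    simp [stepFactor, mul_assoc]

lemma le_of_run_false (h : HasSteps r ρ ω z) (hz : ∀ k, 0 ≤ z k) (hr0 : 0 ≤ r) (hr : r ≤ 1)
    {A k : ℤ} (hA : A ≤ k) (hω : ∀ j, A ≤ j → j < k → ω j = false) : z k ≤ z A := by
  obtain ⟨n, rfl⟩ := Int.le.dest hA
  rw [h.run_false hω]
  exact mul_le_of_le_one_right (hz A) (pow_le_one₀ hr0 hr)

lemma le_of_run_true (h : HasSteps r ρ ω z) (hz : ∀ k, 0 ≤ z k) (hρ : 1 ≤ ρ)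
    {k B : ℤ} (hB : k ≤ B) (hω : ∀ j, k ≤ j → j < B → ω j = true) : z k ≤ z B := by
  obtain ⟨n, rfl⟩ := Int.le.dest hB
  rw [h.run_true hω]
  exact le_mul_of_one_le_right (hz k) (one_le_pow₀ hρ)

end HasSteps

lemma pathProd_eq_zpow_mul_zpow (hr : 0 < r) (hρ : 0 < ρ) (ω : ℤ → Bool) (k : ℤ) :
    ∃ a b : ℤ, a + b = k ∧ pathProd r ρ ω k = r ^ a * ρ ^ b := by
  have hP := hasSteps_pathProd hr hρ ω
  induction k using Int.induction_on with
  | zero => exact ⟨0, 0, by simp⟩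
  | succ k ih =>
    obtain ⟨a, b, hab, e⟩ := ih
    rw [hP k, e]
    cases ω k
    · exact ⟨a + 1, b, by omega, by rw [zpow_add_one₀ hr.ne']; simp [stepFactor]; ring⟩
    · exact ⟨a, b + 1, by omega, by rw [zpow_add_one₀ hρ.ne']; simp [stepFactor]; ring⟩
  | pred k ih =>
    obtain ⟨a, b, hab, e⟩ := ih
    have h := hP (-k - 1)
    rw [sub_add_cancel, e] at h
    cases hω : ω (-k - 1) <;> rw [hω] at h <;> simp only [stepFactor] at h
    · refine ⟨a - 1, b, by omega, ?_⟩
      rw [zpow_sub_one₀ hr.ne']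
      simp at h
      field_simp
      linarith
    · refine ⟨a, b - 1, by omega, ?_⟩
      rw [zpow_sub_one₀ hρ.ne']
      simp at h
      field_simp
      linarith

end PathProducts

/-! ### The inverse limit as a collapsed region, and its height function. -/

section LimitCoordinates

variable {r ρ : ℝ}

instance : T2Space (LelekLimit r ρ) :=
  inferInstanceAs (T2Space {x : ℕ → {y : ℕ → unitInterval // ∀ i, (y i, y (i + 1)) ∈
    lineRelation r ρ} // ∀ i, x i = MahavierProduct.shift (lineRelation r ρ) (x (i + 1))})

namespace LelekLimit

/-- The coordinates of a point of the inverse limit as a bi-infinite sequence. -/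
def coord (x : LelekLimit r ρ) (k : ℤ) : ℝ := (x.1 (-k).toNat).1 k.toNat

lemma val_eq_coord (x : LelekLimit r ρ) (i j : ℕ) : ((x.1 i).1 j : ℝ) = coord x (j - i) := by
  have h1 : ∀ i j, (x.1 i).1 j = (x.1 (i + 1)).1 (j + 1) := fun i j =>
    congrArg (fun y => y.1 j) (x.2 i)
  have h2 : ∀ m i j, (x.1 i).1 j = (x.1 (i + m)).1 (j + m) := by
    intro m
    induction m with
    | zero => exact fun i j => rfl
    | succ m ih => exact fun i j => (ih i j).trans (h1 _ _)
  rw [coord, h2 (min i j) (-((j : ℤ) - i)).toNat,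
    show (-((j : ℤ) - i)).toNat + min i j = i by omega,
    show ((j : ℤ) - i).toNat + min i j = j by omega]

lemma coord_mem (x : LelekLimit r ρ) (k : ℤ) : 0 ≤ coord x k ∧ coord x k ≤ 1 :=
  ((x.1 (-k).toNat).1 k.toNat).2

lemma ext_coord {x y : LelekLimit r ρ} (h : ∀ k, coord x k = coord y k) : x = y := by
  refine Subtype.ext (funext fun i => Subtype.ext (funext fun j => Subtype.ext ?_))
  rw [val_eq_coord, val_eq_coord, h]

lemma continuous_coord (k : ℤ) : Continuous fun x : LelekLimit r ρ => coord x k := by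
  have h1 : Continuous fun x : LelekLimit r ρ => x.1 (-k).toNat :=
    (continuous_apply (-k).toNat).comp continuous_subtype_val
  have h2 : Continuous fun y : MahavierProduct (lineRelation r ρ) => y.1 k.toNat :=
    (continuous_apply k.toNat).comp continuous_subtype_val
  exact continuous_subtype_val.comp (h2.comp h1)

open Classical in
/-- The steps of the coordinate sequence of a point. -/
noncomputable def steps (x : LelekLimit r ρ) (k : ℤ) : Bool :=
  decide (coord x (k + 1) = ρ * coord x k)

lemma hasSteps_coord (x : LelekLimit r ρ) : HasSteps r ρ (steps x) (coord x) := by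
  intro k
  have h : coord x (k + 1) = r * coord x k ∨ coord x (k + 1) = ρ * coord x k := by
    have := (x.1 (-k).toNat).2 k.toNat
    simp only [lineRelation, mem_union, mem_ofPred_eq, val_eq_coord] at this
    rwa [show ((k.toNat + 1 : ℕ) : ℤ) - (-k).toNat = k + 1 by omega,
      show (k.toNat : ℤ) - (-k).toNat = k by omega] at this
  by_cases h' : coord x (k + 1) = ρ * coord x k
  · simp [steps, stepFactor, h', mul_comm]
  · simp [steps, stepFactor, h.resolve_right h', mul_comm]

/-- The point with a prescribed coordinate sequence. -/
def ofSteps {ω : ℤ → Bool} {z : ℤ → ℝ} (hz : ∀ k, 0 ≤ z k ∧ z k ≤ 1) (h : HasSteps r ρ ω z) :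
    LelekLimit r ρ :=
  ⟨fun i => ⟨fun j => ⟨z (j - i), hz _⟩, fun j => by
      have e := h (j - i)
      rw [show (j : ℤ) - i + 1 = (j + 1 : ℕ) - i by push_cast; ring] at e
      cases hω : ω (j - i)
      · left
        simpa [hω, stepFactor, mul_comm] using e
      · right
        simpa [hω, stepFactor, mul_comm] using e⟩,
    fun i => Subtype.ext (funext fun j => Subtype.ext (by
      simp only [MahavierProduct.shift]; push_cast; congr 1; ring))⟩

@[simp]
lemma coord_ofSteps {ω : ℤ → Bool} {z : ℤ → ℝ} (hz : ∀ k, 0 ≤ z k ∧ z k ≤ 1)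
    (h : HasSteps r ρ ω z) (k : ℤ) : coord (ofSteps hz h) k = z k := by
  simp only [coord, ofSteps]
  congr 1
  omega

@[simp]
lemma coord_zero (k : ℤ) : coord (zero r ρ) k = 0 := rfl

lemma coord_shift (x : LelekLimit r ρ) (k : ℤ) :
    coord (InverseLimit.shift _ x) k = coord x (k - 1) := by
  have := val_eq_coord x ((-k).toNat + 1) k.toNat
  rw [coord]
  simp only [InverseLimit.shift]
  rw [this]
  congr 1
  push_cast
  omega

lemma coord_shift_iterate (x : LelekLimit r ρ) (n : ℕ) (k : ℤ) :
    coord ((InverseLimit.shift _)^[n] x) k = coord x (k - n) := by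
  induction n generalizing k with
  | zero => simp
  | succ n ih =>
    rw [Function.iterate_succ_apply', coord_shift, ih]
    congr 1
    push_cast
    ring

/-- The height of the leg with steps `ω`. -/
noncomputable def height (r ρ : ℝ) (ω : ℤ → Bool) : ℝ := ⨅ k, (pathProd r ρ ω k)⁻¹

lemma le_height_iff (hr : 0 < r) (hρ : 0 < ρ) {ω : ℤ → Bool} {t : ℝ} :
    t ≤ height r ρ ω ↔ ∀ k, t * pathProd r ρ ω k ≤ 1 := by
  have hP := pathProd_pos hr hρ ω
  rw [height, le_ciInf_iff ⟨0, by rintro _ ⟨k, rfl⟩; exact (inv_pos.2 (hP k)).le⟩]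
  exact forall_congr' fun k => by rw [← one_mul (pathProd r ρ ω k)⁻¹, le_mul_inv_iff₀ (hP k)]

lemma height_nonneg (hr : 0 < r) (hρ : 0 < ρ) (ω : ℤ → Bool) : 0 ≤ height r ρ ω :=
  (le_height_iff hr hρ).2 fun k => by simp

lemma height_le_one (hr : 0 < r) (hρ : 0 < ρ) (ω : ℤ → Bool) : height r ρ ω ≤ 1 := by
  simpa using (le_height_iff hr hρ (ω := ω)).1 le_rfl 0

lemma upperSemicontinuous_height (hr : 0 < r) (hρ : 0 < ρ) :
    UpperSemicontinuous (height r ρ) := by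
  rw [upperSemicontinuous_iff_isClosed_preimage]
  intro y
  have : height r ρ ⁻¹' Ici y = ⋂ k, {ω | y * pathProd r ρ ω k ≤ 1} := by
    ext ω
    simp [le_height_iff hr hρ]
  rw [this]
  exact isClosed_iInter fun k =>
    isClosed_le (continuous_const.mul (continuous_pathProd hr hρ k)) continuous_const

/-- The parametrization of the inverse limit by steps and the coordinate at `0`. -/
noncomputable def param (hr : 0 < r) (hρ : 0 < ρ) (x : SubgraphRegion (height r ρ)) :
    LelekLimit r ρ :=
  ofSteps (ω := x.1.1) (z := fun k => x.1.2 * pathProd r ρ x.1.1 k)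
    (fun k => ⟨mul_nonneg x.2.1 (pathProd_pos hr hρ _ _).le, (le_height_iff hr hρ).1 x.2.2 k⟩)
    ((hasSteps_pathProd hr hρ _).const_mul _)

@[simp]
lemma coord_param (hr : 0 < r) (hρ : 0 < ρ) (x : SubgraphRegion (height r ρ)) (k : ℤ) :
    coord (param hr hρ x) k = x.1.2 * pathProd r ρ x.1.1 k :=
  coord_ofSteps _ _ k

lemma param_eq (hr : 0 < r) (hρ : 0 < ρ) {x : LelekLimit r ρ} {ω : ℤ → Bool}
    (h : HasSteps r ρ ω (coord x)) :
    ∃ ht, param hr hρ ⟨(ω, coord x 0), (coord_mem x 0).1, ht⟩ = x := by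
  refine ⟨(le_height_iff hr hρ).2 fun k => ?_, ext_coord fun k => ?_⟩
  · rw [← h.eq_mul_pathProd hr hρ]
    exact (coord_mem x k).2
  · rw [coord_param, h.eq_mul_pathProd hr hρ k]

/-- A sequence with positive entries determines its steps because `r ≠ ρ`; the zero sequence admits
every word, so exactly the base is collapsed. -/
theorem isFanParam (hr : 0 < r) (hr1 : r < 1) (hρ : 1 < ρ) :
    IsFanParam (height r ρ) (param hr (one_pos.trans hρ)) (zero r ρ) := by
  have hρ0 := one_pos.trans hρ
  refine ⟨?_, fun x => ⟨_, (param_eq hr hρ0 (hasSteps_coord x)).2⟩, fun x => ⟨fun h => ?_,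
    fun h => ext_coord fun k => by simp [h]⟩, fun x y h h0 => ?_⟩
  · refine Continuous.subtype_mk (continuous_pi fun i => Continuous.subtype_mk
      (continuous_pi fun j => Continuous.subtype_mk ?_ _) _) _
    exact (continuous_snd.comp continuous_subtype_val).mul
      ((continuous_pathProd hr hρ0 _).comp (continuous_fst.comp continuous_subtype_val))
  · simpa using congrArg (coord · 0) h
  · have h2 : x.1.2 = y.1.2 := by simpa using congrArg (coord · 0) h
    have hk : ∀ k, pathProd r ρ x.1.1 k = pathProd r ρ y.1.1 k := fun k => by
      have := congrArg (coord · k) h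
      simp only [coord_param, ← h2] at this
      exact mul_left_cancel₀ h0.ne' this
    refine Subtype.ext (Prod.ext (funext fun k => ?_) h2)
    have := hk (k + 1)
    rw [hasSteps_pathProd hr hρ0, hasSteps_pathProd hr hρ0, hk k] at this
    have := mul_left_cancel₀ (pathProd_pos hr hρ0 _ _).ne' this
    have hne := (hr1.trans hρ).ne
    cases h1 : x.1.1 k <;> cases h2 : y.1.1 k <;> simp_all [stepFactor]

/-- A window of a step sequence determines a neighbourhood. -/
lemma exists_window {V : Set (ℤ → Bool)} (hV : IsOpen V) {ω : ℤ → Bool} (hω : ω ∈ V) :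
    ∃ N : ℕ, ∀ ω' : ℤ → Bool, (∀ k, -(N : ℤ) ≤ k → k < N → ω' k = ω k) → ω' ∈ V := by
  obtain ⟨I, u, hu, hsub⟩ := isOpen_pi_iff.1 hV ω hω
  refine ⟨I.sup Int.natAbs + 1, fun ω' h => hsub fun k hk => ?_⟩
  have : k.natAbs ≤ I.sup Int.natAbs := Finset.le_sup (f := Int.natAbs) hk
  rw [h k (by push_cast; omega) (by push_cast; omega)]
  exact (hu k hk).2

/-- The steps of a window can be extended so that the height is prescribed approximately. -/
lemma exists_height_between (hNC : NeverConnect r ρ) (ω : ℤ → Bool) (N : ℕ) {a T : ℝ} (ha : 0 < a)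
    (haT : a < T) (hT : ∀ k, -(N : ℤ) ≤ k → k ≤ N → T * pathProd r ρ ω k ≤ 1) :
    ∃ ω' : ℤ → Bool, (∀ k, -(N : ℤ) ≤ k → k < N → ω' k = ω k) ∧
      a < height r ρ ω' ∧ height r ρ ω' < T := by
  have hr := hNC.1
  have hr1 := hNC.2.1
  have hρ := hNC.2.2.1
  have hρ0 := one_pos.trans hρ
  have hT0 := ha.trans haT
  obtain ⟨i, j, hij1, hij2⟩ := hNC.exists_pow_mul_pow
    (mul_pos ha (pathProd_pos hr hρ0 ω N)) (div_pos ha hT0) ((div_lt_one hT0).2 haT)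
  -- Factors `ρ` before the window and `r` after index `N + i + j` make the product decay in both
  -- directions. The product peaks at `N + i + j` with value `y` between `1 / T` and `1 / a`, above
  -- the whole window, so the height is `1 / y`.
  let ω' : ℤ → Bool := fun k =>
    if k < -N then true else if k < N then ω k else if k < N + i then false else
      if k < N + i + j then true else false
  have hω' : ∀ k, -(N : ℤ) ≤ k → k < N → ω' k = ω k := fun k h1 h2 => by
    simp only [ω']; rw [if_neg (by omega), if_pos h2]
  have hP := hasSteps_pathProd hr hρ0 ω'
  have hP0 : ∀ k, 0 ≤ pathProd r ρ ω' k := fun k => (pathProd_pos hr hρ0 ω' k).le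
  have hwin : ∀ k, -(N : ℤ) ≤ k → k ≤ N → pathProd r ρ ω' k = pathProd r ρ ω k := fun k h1 h2 =>
    hP.eq_on_window hr hρ0 (hasSteps_pathProd hr hρ0 ω) (by simp) (by omega) (by omega) hω' h1 h2
  have e1 : pathProd r ρ ω' (N + i) = pathProd r ρ ω N * r ^ i := by
    rw [hP.run_false, hwin N (by omega) le_rfl]
    intro k h1 h2
    simp only [ω']
    rw [if_neg (by omega), if_neg (by omega), if_pos h2]
  have e2 : pathProd r ρ ω' (N + i + j) = pathProd r ρ ω N * r ^ i * ρ ^ j := by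
    rw [hP.run_true, e1]
    intro k h1 h2
    simp only [ω']
    rw [if_neg (by omega), if_neg (by omega), if_neg (by omega), if_pos h2]
  set y := pathProd r ρ ω N * r ^ i * ρ ^ j with hy
  have hy1 : 1 < T * y := by
    rw [div_lt_iff₀ hT0] at hij1
    have : a * 1 < a * (T * y) := by rw [hy]; linarith
    exact lt_of_mul_lt_mul_left this ha.le
  have hy2 : a * y < 1 := by rw [hy]; linarith
  have hy0 : 0 < y := pos_of_mul_pos_right (one_pos.trans hy1) hT0.le
  have hTP : ∀ k, T * pathProd r ρ ω k ≤ 1 → pathProd r ρ ω k ≤ y := fun k h =>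
    (lt_of_mul_lt_mul_left (h.trans_lt hy1) hT0.le).le
  have hle : ∀ k, pathProd r ρ ω' k ≤ y := by
    intro k
    rcases le_total k (-N) with h1 | h1
    · refine (hP.le_of_run_true hP0 hρ.le h1 fun m _ hm => if_pos hm).trans ?_
      rw [hwin _ le_rfl (by omega)]
      exact hTP _ (hT _ le_rfl (by omega))
    rcases le_total k N with h2 | h2
    · rw [hwin k h1 h2]
      exact hTP _ (hT _ h1 h2)
    rcases le_total k (N + i) with h3 | h3
    · refine (hP.le_of_run_false hP0 hr.le hr1.le h2 fun m h4 h5 => ?_).trans ?_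
      · simp only [ω']
        rw [if_neg (by omega), if_neg (by omega), if_pos (by omega)]
      · rw [hwin _ (by omega) le_rfl]
        exact hTP _ (hT _ (by omega) le_rfl)
    rw [← e2]
    rcases le_total k (N + i + j) with h4 | h4
    · refine hP.le_of_run_true hP0 hρ.le h4 fun m h5 h6 => ?_
      simp only [ω']
      rw [if_neg (by omega), if_neg (by omega), if_neg (by omega), if_pos h6]
    · refine hP.le_of_run_false hP0 hr.le hr1.le h4 fun m h5 h6 => ?_
      simp only [ω']
      rw [if_neg (by omega), if_neg (by omega), if_neg (by omega), if_neg (by omega)]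
  refine ⟨ω', hω', ?_, ?_⟩
  · have : y⁻¹ ≤ height r ρ ω' := (le_height_iff hr hρ0).2 fun k => by
      rw [inv_mul_le_iff₀ hy0, mul_one]
      exact hle k
    refine lt_of_lt_of_le ?_ this
    rwa [← mul_one y⁻¹, lt_inv_mul_iff₀ hy0, mul_comm]
  · have h1 := (le_height_iff hr hρ0 (ω := ω')).1 le_rfl (N + i + j)
    rw [e2] at h1
    exact lt_of_mul_lt_mul_right (h1.trans_lt hy1) hy0.le

theorem isLelekFunction_height (hNC : NeverConnect r ρ) : IsLelekFunction (height r ρ) := by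
  have hr := hNC.1
  have hρ0 := one_pos.trans hNC.2.2.1
  refine ⟨upperSemicontinuous_height hr hρ0, height_nonneg hr hρ0, height_le_one hr hρ0, ?_, ?_⟩
  · rintro V hV ⟨ω, hω⟩
    obtain ⟨N, hN⟩ := exists_window hV hω
    have hne : (Finset.Icc (-(N : ℤ)) N).Nonempty := ⟨0, by simp⟩
    obtain ⟨m, -, hm⟩ := Finset.exists_max_image _ (pathProd r ρ ω) hne
    have hm0 := pathProd_pos hr hρ0 ω m
    obtain ⟨ω', h1, h2, -⟩ := exists_height_between hNC ω N (half_pos (inv_pos.2 hm0))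
      (half_lt_self (inv_pos.2 hm0)) fun k h1 h2 => by
        rw [inv_mul_le_iff₀ hm0, mul_one]
        exact hm k (Finset.mem_Icc.2 ⟨h1, h2⟩)
    exact ⟨ω', hN ω' h1, (half_pos (inv_pos.2 hm0)).trans h2⟩
  · intro V hV ω hω a b ha hab hb
    obtain ⟨N, hN⟩ := exists_window hV hω
    -- The midpoint replaces `a`, which may be `0`.
    obtain ⟨ω', h1, h2, h3⟩ := exists_height_between hNC ω N (show 0 < (a + b) / 2 by linarith)
      (show (a + b) / 2 < b by linarith) fun k _ _ => (le_height_iff hr hρ0).1 hb k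
    exact ⟨ω', hN ω' h1, by linarith, h3⟩

end LelekLimit

end LimitCoordinates

/-! ### Transitivity, sensitivity and periodic points of the shift. -/

section Dynamics

variable {r ρ : ℝ}

namespace LelekLimit

/-- Closeness is needed only from below: constructed orbits are scaled down by a factor at most `1`,
so as to stay in `[0,1]`. -/
lemma exists_window_of_mem (hr : 0 < r) (hρ : 0 < ρ) (hc : Continuous (param hr hρ))
    {U : Set (LelekLimit r ρ)} (hU : IsOpen U) {x : LelekLimit r ρ} (hx : x ∈ U)
    {ω : ℤ → Bool} (hω : HasSteps r ρ ω (coord x)) (h0 : 0 < coord x 0) :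
    ∃ N : ℕ, ∃ κ : ℝ, 0 < κ ∧ κ < 1 ∧ ∀ (y : LelekLimit r ρ) (ω' : ℤ → Bool),
      HasSteps r ρ ω' (coord y) → (∀ k, -(N : ℤ) ≤ k → k < N → ω' k = ω k) →
      κ * coord x 0 < coord y 0 → coord y 0 ≤ coord x 0 → y ∈ U := by
  obtain ⟨O, hO, hpO⟩ := isOpen_induced_iff.1 (hU.preimage hc)
  obtain ⟨ht, hx'⟩ := param_eq hr hρ hω
  have hmem : (ω, coord x 0) ∈ O := by
    have : (⟨(ω, coord x 0), (coord_mem x 0).1, ht⟩ : SubgraphRegion (height r ρ)) ∈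
        Subtype.val ⁻¹' O := by
      rw [hpO, mem_preimage, hx']; exact hx
    exact this
  obtain ⟨V, W, hV, hW, hωV, htW, hVW⟩ := isOpen_prod_iff.1 hO _ _ hmem
  obtain ⟨N, hN⟩ := exists_window hV hωV
  obtain ⟨ε, hε, hball⟩ := Metric.isOpen_iff.1 hW _ htW
  rw [Real.ball_eq_Ioo] at hball
  refine ⟨N, max (1 / 2) (1 - ε / coord x 0), lt_max_of_lt_left (by norm_num),
    max_lt (by norm_num) (by linarith [div_pos hε h0]), fun y ω' hω' hwin h1 h2 => ?_⟩
  obtain ⟨ht', hy'⟩ := param_eq hr hρ hω'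
  have h3 : coord x 0 - ε < coord y 0 := by
    have h4 := mul_le_mul_of_nonneg_right (le_max_right (1 / 2) (1 - ε / coord x 0)) h0.le
    rw [sub_mul, one_mul, div_mul_cancel₀ _ h0.ne'] at h4
    linarith
  have : (⟨(ω', coord y 0), (coord_mem y 0).1, ht'⟩ : SubgraphRegion (height r ρ)) ∈
      Subtype.val ⁻¹' O := hVW ⟨hN ω' hwin, hball ⟨h3, by linarith⟩⟩
  rw [hpO, mem_preimage, hy'] at this
  exact this

lemma coord_pos (hr : 0 < r) (hρ : 0 < ρ) {x : LelekLimit r ρ} (h0 : 0 < coord x 0) (k : ℤ) :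
    0 < coord x k := by
  rw [(hasSteps_coord x).eq_mul_pathProd hr hρ]
  exact mul_pos h0 (pathProd_pos hr hρ _ _)

/-- Two windows can be joined by a single orbit. -/
lemma exists_joining (hNC : NeverConnect r ρ) {x₁ x₂ : LelekLimit r ρ} {ω₁ ω₂ : ℤ → Bool}
    (hω₁ : HasSteps r ρ ω₁ (coord x₁)) (hω₂ : HasSteps r ρ ω₂ (coord x₂))
    (h₁ : 0 < coord x₁ 0) (h₂ : 0 < coord x₂ 0) (N : ℕ) {κ : ℝ} (hκ0 : 0 < κ) (hκ : κ < 1) :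
    ∃ (n : ℕ) (y : LelekLimit r ρ) (ω : ℤ → Bool), N ≤ n ∧ HasSteps r ρ ω (coord y) ∧
      (∀ k, -(N : ℤ) ≤ k → k < N → ω k = ω₂ k) ∧
      (∀ k, -(N : ℤ) ≤ k → k < N → ω (k - n) = ω₁ k) ∧
      κ * coord x₂ 0 < coord y 0 ∧ coord y 0 ≤ coord x₂ 0 ∧ coord y (-n) = coord x₁ 0 := by
  have hr := hNC.1
  have hr1 := hNC.2.1
  have hρ := hNC.2.2.1
  have hρ0 := one_pos.trans hρ
  have hb := coord_pos hr hρ0 h₂ (-N)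
  obtain ⟨i, j, hij1, hij2⟩ := hNC.exists_pow_mul_pow
    (div_pos (coord_pos hr hρ0 h₁ N) hb) hκ0 hκ
  let m : ℤ := 2 * N + i + j
  -- The window of `x₁`, then `i` factors `r` and `j` factors `ρ`, then the window of `x₂`, with
  -- decay outside. The values in the second window are those of `x₂` times `lam`, which lies
  -- between `κ` and `1`.
  let ω : ℤ → Bool := fun k =>
    if k < -N then true else if k < N then ω₁ k else if k < N + i then false else
      if k < N + i + j then true else if k < m + N then ω₂ (k - m) else false
  have hwin1 : ∀ k, -(N : ℤ) ≤ k → k < N → ω k = ω₁ k := fun k h1 h2 => by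
    simp only [ω]; rw [if_neg (by omega), if_pos h2]
  have hwin2 : ∀ k, -(N : ℤ) ≤ k → k < N → ω (k + m) = ω₂ k := fun k h1 h2 => by
    simp only [ω, m]
    rw [if_neg (by omega), if_neg (by omega), if_neg (by omega), if_neg (by omega),
      if_pos (by omega)]
    congr 1
    ring
  let z : ℤ → ℝ := fun k => coord x₁ 0 * pathProd r ρ ω k
  have hz : HasSteps r ρ ω z := (hasSteps_pathProd hr hρ0 ω).const_mul _
  have hz0 : ∀ k, 0 ≤ z k := fun k => mul_nonneg h₁.le (pathProd_pos hr hρ0 ω k).le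
  have e0 : ∀ k, -(N : ℤ) ≤ k → k ≤ N → z k = coord x₁ k := fun k h1 h2 =>
    hz.eq_on_window hr hρ0 hω₁ (by simp [z]) (by omega) (by omega) hwin1 h1 h2
  have e1 : z (N + i) = coord x₁ N * r ^ i := by
    rw [hz.run_false, e0 N (by omega) le_rfl]
    intro k h1 h2
    simp only [ω]
    rw [if_neg (by omega), if_neg (by omega), if_pos h2]
  have e2 : z (N + i + j) = coord x₁ N * r ^ i * ρ ^ j := by
    rw [hz.run_true, e1]
    intro k h1 h2
    simp only [ω]
    rw [if_neg (by omega), if_neg (by omega), if_neg (by omega), if_pos h2]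
  set lam := coord x₁ N / coord x₂ (-N) * r ^ i * ρ ^ j with hlam
  have e3 : z (-N + m) = lam * coord x₂ (-N) := by
    rw [show -(N : ℤ) + m = N + i + j by simp only [m]; ring, e2, hlam]
    field_simp
  have e4 : ∀ k, -(N : ℤ) ≤ k → k ≤ N → z (k + m) = lam * coord x₂ k := by
    intro k h1 h2
    have := (hz.shift m).mul_eq_mul hω₂ hwin2 h1 h2
    rw [e3] at this
    apply mul_right_cancel₀ hb.ne'
    linear_combination this
  have hle : ∀ k, z k ≤ 1 := by
    intro k
    rcases le_total k (-N) with h1 | h1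
    · refine (hz.le_of_run_true hz0 hρ.le h1 fun m _ hm => if_pos hm).trans ?_
      rw [e0 _ le_rfl (by omega)]
      exact (coord_mem _ _).2
    rcases le_total k N with h2 | h2
    · rw [e0 k h1 h2]
      exact (coord_mem _ _).2
    rcases le_total k (N + i) with h3 | h3
    · refine (hz.le_of_run_false hz0 hr.le hr1.le h2 fun m h4 h5 => ?_).trans ?_
      · simp only [ω]
        rw [if_neg (by omega), if_neg (by omega), if_pos (by omega)]
      · rw [e0 _ (by omega) le_rfl]
        exact (coord_mem _ _).2
    have hw : ∀ k, -(N : ℤ) ≤ k → k ≤ N → z (k + m) ≤ 1 := fun k h1 h2 => by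
      rw [e4 k h1 h2]
      exact mul_le_one₀ hij2.le (coord_mem _ _).1 (coord_mem _ _).2
    rcases le_total k (N + i + j) with h4 | h4
    · refine (hz.le_of_run_true hz0 hρ.le h4 fun m h5 h6 => ?_).trans ?_
      · simp only [ω]
        rw [if_neg (by omega), if_neg (by omega), if_neg (by omega), if_pos h6]
      · have := hw (-N) le_rfl (by omega)
        rwa [show -(N : ℤ) + m = N + i + j by simp only [m]; ring] at this
    rcases le_total k (m + N) with h5 | h5
    · have := hw (k - m) (by simp only [m]; omega) (by omega)
      rwa [sub_add_cancel] at this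
    · refine (hz.le_of_run_false hz0 hr.le hr1.le h5 fun l h6 h7 => ?_).trans ?_
      · simp only [ω, m] at h6 ⊢
        rw [if_neg (by omega), if_neg (by omega), if_neg (by omega), if_neg (by omega),
          if_neg (by omega)]
      · rw [add_comm]
        exact hw N (by omega) le_rfl
  have hsh := hz.shift m
  refine ⟨2 * N + i + j, ofSteps (fun k => ⟨hz0 (k + m), hle _⟩) hsh, _, by omega, ?_, hwin2,
    fun k h1 h2 => ?_, ?_, ?_, ?_⟩
  · intro k
    simp only [coord_ofSteps]
    exact hsh k
  · rw [← hwin1 k h1 h2]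
    congr 1
    simp only [m]; push_cast; ring
  · rw [coord_ofSteps, e4 0 (by omega) (by omega)]
    exact mul_lt_mul_of_pos_right hij1 h₂
  · rw [coord_ofSteps, e4 0 (by omega) (by omega)]
    exact mul_le_of_le_one_left h₂.le hij2.le
  · rw [coord_ofSteps]
    have : -((2 * N + i + j : ℕ) : ℤ) + m = 0 := by simp only [m]; push_cast; ring
    rw [this]
    simp [z]

lemma exists_coord_pos (hNC : NeverConnect r ρ) {U : Set (LelekLimit r ρ)} (hU : IsOpen U)
    (hne : U.Nonempty) : ∃ x ∈ U, 0 < coord x 0 := by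
  obtain ⟨c, hc, h⟩ := (isFanParam hNC.1 hNC.2.1 hNC.2.2.1).exists_leg_end_mem
    (isLelekFunction_height hNC) hU hne
  exact ⟨_, h, by simpa using hc⟩

lemma exists_shift_iterate_mem (hNC : NeverConnect r ρ) {U V : Set (LelekLimit r ρ)}
    (hU : IsOpen U) (hV : IsOpen V) (hUne : U.Nonempty) (hVne : V.Nonempty) (n₀ : ℕ) :
    ∃ n ≥ n₀, ∃ x ∈ U, (InverseLimit.shift _)^[n] x ∈ V := by
  -- The shift reads the coordinate sequence backwards, so the starting set `U` supplies the later
  -- window.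
  obtain ⟨x₂, hx₂, h₂⟩ := exists_coord_pos hNC hU hUne
  obtain ⟨x₁, hx₁, h₁⟩ := exists_coord_pos hNC hV hVne
  have hc := (isFanParam hNC.1 hNC.2.1 hNC.2.2.1).continuous
  have hω₁ := hasSteps_coord x₁
  have hω₂ := hasSteps_coord x₂
  obtain ⟨N₂, κ, hκ0, hκ, hN₂⟩ := exists_window_of_mem _ _ hc hU hx₂ hω₂ h₂
  obtain ⟨N₁, κ', hκ0', hκ', hN₁⟩ := exists_window_of_mem _ _ hc hV hx₁ hω₁ h₁
  obtain ⟨n, y, ω, hn, hω, hw₂, hw₁, hy1, hy2, hy3⟩ :=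
    exists_joining hNC hω₁ hω₂ h₁ h₂ (max n₀ (max N₁ N₂)) hκ0 hκ
  refine ⟨n, (le_max_left _ _).trans hn, y, hN₂ y ω hω (fun k h1 h2 => hw₂ k ?_ ?_) hy1 hy2, ?_⟩
  · push_cast; omega
  · push_cast; omega
  have hcoord : ∀ k, coord ((InverseLimit.shift _)^[n] y) k = coord y (k + -n) := fun k =>
    coord_shift_iterate y n k
  refine hN₁ _ (fun k => ω (k + -n)) (fun k => ?_) (fun k h1 h2 => hw₁ k ?_ ?_) ?_ ?_
  · rw [hcoord, hcoord]
    exact hω.shift (-n) k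
  · push_cast; omega
  · push_cast; omega
  · rw [hcoord, zero_add, hy3]
    exact mul_lt_of_lt_one_left h₁ hκ'
  · rw [hcoord, zero_add, hy3]

lemma exists_coord_gt_half (hr : 0 < r) (hr1 : r < 1) (hρ : 1 < ρ) :
    ∃ x : LelekLimit r ρ, 1 / 2 < coord x 0 := by
  have hρ0 := one_pos.trans hρ
  let ω : ℤ → Bool := fun k => if k < 0 then true else false
  have hP := hasSteps_pathProd hr hρ0 ω
  have hP0 : ∀ k, 0 ≤ pathProd r ρ ω k := fun k => (pathProd_pos hr hρ0 ω k).le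
  refine ⟨ofSteps (fun k => ⟨hP0 k, ?_⟩) hP, by simp; norm_num⟩
  rw [← pathProd_zero (r := r) (ρ := ρ) ω]
  rcases le_total k 0 with h | h
  · exact hP.le_of_run_true hP0 hρ.le h fun j _ hj => if_pos hj
  · exact hP.le_of_run_false hP0 hr.le hr1.le h fun j hj _ => if_neg (by omega)

/-- In every open set there are points whose orbits are eventually near to the top. -/
lemma exists_coord_neg_le (hNC : NeverConnect r ρ) {U : Set (LelekLimit r ρ)} (hU : IsOpen U)
    (hne : U.Nonempty) : ∃ n₀ : ℕ, ∃ y ∈ U, ∀ n : ℕ, n₀ ≤ n → coord y (-n) ≤ 1 / 4 := by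
  obtain ⟨x, hx, h⟩ := exists_coord_pos hNC hU hne
  have hr := hNC.1
  have hρ := hNC.2.2.1
  have hρ0 := one_pos.trans hρ
  have hc := (isFanParam hr hNC.2.1 hρ).continuous
  have hω := hasSteps_coord x
  obtain ⟨N, κ, hκ0, hκ, hN⟩ := exists_window_of_mem _ _ hc hU hx hω h
  obtain ⟨m, hm⟩ := pow_unbounded_of_one_lt 4 hρ
  -- With only factors `ρ` before `-N`, values at least `m` places further back are at most `1 / ρ ^
  -- m < 1 / 4`.
  let ω : ℤ → Bool := fun k => if k < -N then true else steps x k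
  have hωx : ∀ k, -(N : ℤ) ≤ k → ω k = steps x k := fun k hk => if_neg (by omega)
  let z : ℤ → ℝ := fun k => coord x 0 * pathProd r ρ ω k
  have hz : HasSteps r ρ ω z := (hasSteps_pathProd hr hρ0 ω).const_mul _
  have hz0 : ∀ k, 0 ≤ z k := fun k => mul_nonneg h.le (pathProd_pos hr hρ0 ω k).le
  have e0 : ∀ k, -(N : ℤ) ≤ k → z k = coord x k := fun k h1 =>
    hz.eq_on_window hr hρ0 hω (by simp [z]) (A := -N) (B := max k 0) (by omega) (by omega)
      (fun k h1 _ => hωx k h1) h1 (by omega)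
  have hle : ∀ k, z k ≤ 1 := by
    intro k
    rcases le_total k (-N) with h1 | h1
    · refine (hz.le_of_run_true hz0 hρ.le h1 fun m _ hm => if_pos hm).trans ?_
      rw [e0 _ le_rfl]
      exact (coord_mem _ _).2
    · rw [e0 k h1]
      exact (coord_mem _ _).2
  refine ⟨N + m, ofSteps (fun k => ⟨hz0 k, hle k⟩) hz, hN _ ω (fun k => ?_)
    (fun k h1 _ => hωx k h1) ?_ ?_, fun n hn => ?_⟩
  · simp only [coord_ofSteps]; exact hz k
  · rw [coord_ofSteps, e0 0 (by omega)]; exact mul_lt_of_lt_one_left h hκ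
  · rw [coord_ofSteps, e0 0 (by omega)]
  · rw [coord_ofSteps]
    have e1 := hz.run_true (A := -((N : ℤ) + m)) (n := m) fun k h1 h2 => if_pos (by omega)
    have h2 : z (-n) ≤ z (-((N : ℤ) + m)) :=
      hz.le_of_run_true hz0 hρ.le (by omega) fun k h1 h2 => if_pos (by omega)
    have h3 := hle (-((N : ℤ) + m) + m)
    rw [e1] at h3
    have h4 := mul_le_mul_of_nonneg_left hm.le (hz0 (-((N : ℤ) + m)))
    linarith

/-- At a common late time one point of `U` has value at most `1/4` and another more than `1/2`; the
value of `x` is at least `1/8` away from one of them. -/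
lemma exists_coord_far (hNC : NeverConnect r ρ) (x : LelekLimit r ρ) {U : Set (LelekLimit r ρ)}
    (hU : IsOpen U) (hx : x ∈ U) : ∃ y ∈ U, ∃ n : ℕ, 0 < n ∧
      1 / 8 ≤ |coord ((InverseLimit.shift _)^[n] x) 0 - coord ((InverseLimit.shift _)^[n] y) 0| := by
  obtain ⟨n₀, y, hy, hyn⟩ := exists_coord_neg_le hNC hU ⟨x, hx⟩
  obtain ⟨n, hn, w, hw, hwn⟩ := exists_shift_iterate_mem hNC hU
    (isOpen_lt continuous_const (continuous_coord 0)) ⟨x, hx⟩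
    (exists_coord_gt_half hNC.1 hNC.2.1 hNC.2.2.1) (n₀ + 1)
  have h1 := hyn n (by omega)
  have hwn' : 1 / 2 < coord ((InverseLimit.shift _)^[n] w) 0 := hwn
  by_cases h : 1 / 8 ≤ |coord ((InverseLimit.shift _)^[n] x) 0 -
      coord ((InverseLimit.shift _)^[n] y) 0|
  · exact ⟨y, hy, n, by omega, h⟩
  · refine ⟨w, hw, n, by omega, ?_⟩
    rw [not_le, abs_lt] at h
    have h2 : coord ((InverseLimit.shift _)^[n] y) 0 ≤ 1 / 4 := by
      rw [coord_shift_iterate, zero_sub]; exact h1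
    rw [abs_sub_comm]
    refine le_trans ?_ (le_abs_self _)
    linarith [h.2]

lemma periodicPts_shift (hNC : NeverConnect r ρ) :
    Function.periodicPts (InverseLimit.shift (MahavierProduct.shift (lineRelation r ρ))) =
      {zero r ρ} := by
  have hr := hNC.1
  have hρ0 := one_pos.trans hNC.2.2.1
  ext x
  constructor
  · rintro ⟨n, hn, hx⟩
    have h1 : coord x (-n) = coord x 0 := by
      have := congrArg (coord · 0) hx
      simpa only [coord_shift_iterate, zero_sub] using this
    rw [(hasSteps_coord x).eq_mul_pathProd hr hρ0] at h1
    by_cases h0 : coord x 0 = 0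
    · refine ext_coord fun k => ?_
      rw [(hasSteps_coord x).eq_mul_pathProd hr hρ0, h0]
      simp
    · have h2 : pathProd r ρ (steps x) (-n) = 1 := mul_left_cancel₀ h0 (h1.trans (mul_one _).symm)
      -- The exponents add up to `-n ≠ 0`, so they cannot both vanish.
      obtain ⟨a, b, hab, e⟩ := pathProd_eq_zpow_mul_zpow hr hρ0 (steps x) (-n)
      rw [h2] at e
      have h3 : r ^ a = ρ ^ (-b) := by
        rw [zpow_neg]
        exact eq_inv_of_mul_eq_one_left e.symm
      obtain ⟨ha, hb⟩ := (hNC.2.2.2 a (-b)).1 h3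
      omega
  · rintro rfl
    exact ⟨1, one_pos, rfl⟩

/-- The shift as a homeomorphism of the inverse limit. -/
def shiftHomeomorph (r ρ : ℝ) : LelekLimit r ρ ≃ₜ LelekLimit r ρ where
  toFun := InverseLimit.shift _
  invFun x := ⟨fun i => MahavierProduct.shift _ (x.1 i), fun i => congrArg _ (x.2 i)⟩
  left_inv x := Subtype.ext (funext fun i => (x.2 i).symm)
  right_inv x := Subtype.ext (funext fun i => (x.2 i).symm)
  continuous_toFun := by
    have h : Continuous fun (x : LelekLimit r ρ) (i : ℕ) => x.1 (i + 1) :=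
      continuous_pi fun i => (continuous_apply (i + 1)).comp continuous_subtype_val
    exact h.subtype_mk _
  continuous_invFun := by
    have h : Continuous fun (x : MahavierProduct (lineRelation r ρ)) (i : ℕ) => x.1 (i + 1) :=
      continuous_pi fun i => (continuous_apply (i + 1)).comp continuous_subtype_val
    have h' : Continuous (MahavierProduct.shift (lineRelation r ρ)) := h.subtype_mk _
    exact Continuous.subtype_mk (continuous_pi fun i =>
      h'.comp ((continuous_apply i).comp continuous_subtype_val)) _

end LelekLimit

/-- The Cantor set as the space of bi-infinite step sequences. -/
noncomputable def stepSequencesHomeomorphCantorSet : (ℤ → Bool) ≃ₜ cantorSet :=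
  (Homeomorph.piCongrLeft (Y := fun _ : ℕ => Bool) Equiv.intEquivNat).trans
    cantorSetHomeomorphNatToBool.symm

end Dynamics

/-! ### Transport of the shift to an arbitrary Lelek fan. -/

theorem mainTheorem7 :
    (∃ r ρ : ℝ, NeverConnect r ρ) ∧
    ∀ r ρ : ℝ, NeverConnect r ρ →
      IsLelekFan (LelekLimit r ρ) ∧
      IsFanTop (LelekLimit.zero r ρ) ∧
      ∀ (L : Type*) [MetricSpace L] (v : L), IsLelekFan L → IsFanTop v →
        ∃ f : L ≃ₜ L,
          IsTransitiveSystem f ∧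
          HasSensitiveDependence f ∧
          Function.periodicPts f = {v} ∧
          ¬ Dense (Function.periodicPts f) ∧
          ∃ φ : LelekLimit r ρ ≃ₜ L, ∀ x, φ (InverseLimit.shift _ x) = f (φ x) := by
  refine ⟨⟨_, _, neverConnect_half_three⟩, fun r ρ hNC => ?_⟩
  have hφ := LelekLimit.isLelekFunction_height hNC
  have hp := LelekLimit.isFanParam hNC.1 hNC.2.1 hNC.2.2.1
  refine ⟨hp.isLelekFan hφ stepSequencesHomeomorphCantorSet, hp.isFanTop hφ, ?_⟩
  intro L _ v hL hv
  obtain ⟨K, ψ, q, hKc, hKt, hKne, hψ, hq⟩ := hL.exists_isFanParam hv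
  have := isCompact_iff_compactSpace.1 hKc
  have := totallyDisconnectedSpace_subtype_iff.2 hKt
  have := hKne.to_subtype
  obtain ⟨e, he⟩ := IsFanParam.exists_homeomorph hφ hψ hp hq
  have hLc := hL.compactSpace
  have hLn := hL.nontrivial
  let f : L ≃ₜ L := e.symm.trans ((LelekLimit.shiftHomeomorph r ρ).trans e)
  have hconj : Function.Semiconj e (InverseLimit.shift _) f := fun x => by
    simp only [f, Homeomorph.trans_apply, Homeomorph.symm_apply_apply]
    rfl
  have hiter : ∀ n x, f^[n] (e x) = e ((InverseLimit.shift _)^[n] x) := fun n x =>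
    ((hconj.iterate_right n) x).symm
  have hper : Function.periodicPts f = {v} := by
    ext y
    obtain ⟨x, rfl⟩ := e.surjective y
    have h1 : e x ∈ Function.periodicPts f ↔ x ∈ Function.periodicPts
        (InverseLimit.shift (MahavierProduct.shift (lineRelation r ρ))) := by
      refine exists_congr fun n => and_congr_right fun _ => ?_
      rw [Function.IsPeriodicPt, Function.IsFixedPt, hiter, e.injective.eq_iff]
      rfl
    rw [h1, LelekLimit.periodicPts_shift hNC, mem_singleton_iff, mem_singleton_iff, ← he,
      e.injective.eq_iff]
  refine ⟨f, ?_, ?_, hper, ?_, e, hconj⟩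
  · intro U V hU hV hUne hVne
    obtain ⟨n, -, x, hxU, hxV⟩ := LelekLimit.exists_shift_iterate_mem hNC
      (hU.preimage e.continuous) (hV.preimage e.continuous)
      (hUne.preimage e.surjective) (hVne.preimage e.surjective) 0
    exact ⟨n, f^[n] (e x), ⟨e x, hxU, rfl⟩, by rw [hiter]; exact hxV⟩
  -- Uniform continuity turns a gap of `1/8` in the coordinate into a distance of at least `ε` for
  -- the given metric of `L`; halving `ε` gives the strict inequality.
  · have huc : UniformContinuous fun y : L => LelekLimit.coord (e.symm y) 0 :=
      CompactSpace.uniformContinuous_of_continuous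
        ((LelekLimit.continuous_coord 0).comp e.symm.continuous)
    obtain ⟨ε, hε, h⟩ := Metric.uniformContinuous_iff.1 huc (1 / 8) (by norm_num)
    refine ⟨ε / 2, half_pos hε, fun y δ hδ => ?_⟩
    obtain ⟨x, rfl⟩ := e.surjective y
    obtain ⟨w, hw, n, hn, hfar⟩ := LelekLimit.exists_coord_far hNC x
      (Metric.isOpen_ball.preimage e.continuous) (Metric.mem_ball_self (x := e x) hδ)
    refine ⟨e w, hw, n, hn, ?_⟩
    rw [hiter, hiter]
    by_contra! hlt
    have := h (hlt.trans_lt (half_lt_self hε))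
    rw [e.symm_apply_apply, e.symm_apply_apply, Real.dist_eq] at this
    exact absurd this (not_lt.2 hfar)
  · rw [hper]
    intro hd
    have hu : ({v} : Set L) = univ := by rw [← hd.closure_eq, closure_singleton]
    obtain ⟨y, hy⟩ := exists_ne v
    exact hy (by simpa using hu.symm.subset (mem_univ y))
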